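/- Let $d\in\{2,3\}$, let $\Omega\subset\mathbb{R}^d$ be a bounded simply connected Lipschitz domain, and let $E,t>0$, $-1<\nu\le 1/2$ be such that $\mathcal{C}\kappa:=\frac{Et^3}{12(1-\nu^2)}\,[\nu\,\mathrm{tr}(\kappa)\,I+(1-\nu)\kappa]$ is positive definite on symmetric $d\times d$ tensors (automatic for $d=2$). A mesh $\mathcal{T}$ is a finite collection of pairwise disjoint, bounded, nonempty open Lipschitz sets $T\subset\Omega$ covering $\Omega$ up to a null set. Write $\varepsilon\nabla z$ for the (symmetrized) Hessian, $\|\cdot\|$ and $(\cdot,\cdot)$ for the $L_2(\Omega)$ norm and inner product, $(\cdot,\cdot)_T$ for those on $T$, and an index $\mathcal{T}$ for differential operators taken piecewise. Let - $H^2(\mathcal{T})$ be the space of $z\in L_2(\Omega)$ with $\varepsilon\nabla (z|_T)\in L_2(T)$ for all $T\in\mathcal{T}$, with norm $\|z\|_{2,\mathcal{T}}^2=\|z\|^2+\|\varepsilon_{\mathcal T}\nabla_{\mathcal T} z\|^2$; - $H(\mathrm{div\,div},\mathcal{T})$ be the space of symmetric tensor functions $\Theta\in\mathbb{L}_2^s(\Omega)$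 with $\mathrm{div\,div}(\Theta|_T)\in L_2(T)$ for all $T\in\mathcal{T}$, with norm $(\|\Theta\|^2+\|\mathrm{div}_{\mathcal T}\mathrm{div}_{\mathcal T}\Theta\|^2)^{1/2}$, and $H(\mathrm{div\,div},\Omega)$ the corresponding unbroken space; - $H^2_0(\Omega)$ be the closure of $C_c^\infty(\Omega)$ in the norm $(\|z\|^2+\|\varepsilon\nabla z\|^2)^{1/2}$. For $\Theta\in H(\mathrm{div\,div},\Omega)$ and $z\in H^2(\mathcal{T})$, and likewise for $z\in H^2_0(\Omega)$ and $\Theta\in H(\mathrm{div\,div},\mathcal{T})$, put $$\langle \mathrm{tr}^{\mathrm{dDiv}}(\Theta),z\rangle_{\mathcal S}:=\sum_{T\in\mathcal{T}}\big[(\mathrm{div\,div}\,\Theta,z)_T-(\Theta,\varepsilon\nabla z)_T\big]=:\langle \mathrm{tr}^{\mathrm{gGrad}}(z),\Theta\rangle_{\mathcal S}.$$ Let $\mathbf{H}^{-3/2,-1/2}(\mathcal{S})=\mathrm{tr}^{\mathrm{dDiv}}(H(\mathrm{div\,div},\Omega))\subset H^2(\mathcal{T})'$ and $\mathbf{H}^{3/2,1/2}_{00}(\mathcal{S})=\mathrm{tr}^{\mathrm{gGrad}}(H^2_0(\Omega))\subset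 H(\mathrm{div\,div},\mathcal{T})'$, both with the dual norm. Let $$\mathcal{U}=L_2(\Omega)\times\mathbb{L}_2^s(\Omega)\times\mathbf{H}^{3/2,1/2}_{00}(\mathcal{S})\times\mathbf{H}^{-3/2,-1/2}(\mathcal{S}),\qquad \mathcal{V}=H^2(\mathcal{T})\times H(\mathrm{div\,div},\mathcal{T})$$ with the product (Hilbertian sum) norms and, for $\mathbf{u}=(u,M,\hat u,\hat q)\in\mathcal{U}$ and $\mathbf{v}=(z,\Theta)\in\mathcal{V}$, $$b(\mathbf{u},\mathbf{v})=(M,\varepsilon_{\mathcal T}\nabla_{\mathcal T} z+\mathcal{C}^{-1}\Theta)+(u,\mathrm{div}_{\mathcal T}\mathrm{div}_{\mathcal T}\Theta)+\langle\hat q,z\rangle_{\mathcal S}-\langle\hat u,\Theta\rangle_{\mathcal S},\qquad L(\mathbf{v})=-(f,z).$$ Let $B:\mathcal{U}\to\mathcal{V}'$ be induced by $b$, and let $\mathrm{T}:\mathcal{U}\to\mathcal{V}$ be defined by $(\mathrm{T}\mathbf{u},\mathbf{v})_{\mathcal V}=b(\mathbf{u},\mathbf{v})$ for all $\mathbf{v}\in\mathcal{V}$.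 Theorem. There is a constant $C>0$, depending only on $d$, $\Omega$ and $\mathcal{C}$, such that for every mesh $\mathcal{T}$ the following holds. The energy norm is equivalent to the norm of $\mathcal{U}$: $\|\mathbf{w}\|_{\mathcal U}\le C\|B\mathbf{w}\|_{\mathcal{V}'}$ and $\|B\mathbf{w}\|_{\mathcal{V}'}\le C\|\mathbf{w}\|_{\mathcal U}$ for all $\mathbf{w}\in\mathcal{U}$. Moreover, for every $f\in L_2(\Omega)$, the problem $b(\mathbf{u},\mathbf{v})=L(\mathbf{v})$ for all $\mathbf{v}\in\mathcal{V}$ has a unique solution $\mathbf{u}\in\mathcal{U}$, and for every finite-dimensional subspace $\mathcal{U}_h\subset\mathcal{U}$ there is a unique $\mathbf{u}_h\in\mathcal{U}_h$ with $$b(\mathbf{u}_h,\mathrm{T}\mathbf{w})=L(\mathrm{T}\mathbf{w})\quad\text{for all }\mathbf{w}\in\mathcal{U}_h,$$ and it satisfies $\|\mathbf{u}-\mathbf{u}_h\|_{\mathcal U}\le C\|\mathbf{u}-\mathbf{w}\|_{\mathcal U}$ for all $\mathbf{w}\in\mathcal{U}_h$. The constant $C$ is independent of $f$, $\mathcal{T}$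 and $\mathcal{U}_h$. -/

import Mathlib

open MeasureTheory Set
open scoped ContDiff InnerProductSpace

noncomputable section

namespace Plate

/-! ### Lipschitz domains and meshes -/

/-- Euclidean space of dimension `d`. -/
abbrev Euc (d : ℕ) := EuclideanSpace ℝ (Fin d)

/-- A bounded open set with Lipschitz boundary: near each boundary point it is, in a direction
`n`, the strict epigraph of a Lipschitz function of the component orthogonal to `n`. -/
structure IsLipschitzSet {d : ℕ} (G : Set (Euc d)) : Prop where
  isOpen : IsOpen G
  isBounded : Bornology.IsBounded G
  nonempty : G.Nonempty
  boundary : ∀ x ∈ frontier G, ∃ n : Euc d, ‖n‖ = 1 ∧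
    ∃ (K : NNReal) (γ : Euc d → ℝ), LipschitzWith K γ ∧
      ∃ W : Set (Euc d), IsOpen W ∧ x ∈ W ∧
        ∀ y ∈ W, (y ∈ G ↔ γ (y - ⟪n, y⟫_ℝ • n) < ⟪n, y⟫_ℝ)

/-- A mesh of `Ω`: finitely many pairwise disjoint open Lipschitz elements contained in `Ω`
that cover `Ω` up to a null set. -/
structure Mesh {d : ℕ} (Ω : Set (Euc d)) where
  elements : Finset (Set (Euc d))
  lipschitz : ∀ T ∈ elements, IsLipschitzSet T
  subset : ∀ T ∈ elements, T ⊆ Ω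
  disjoint : ∀ T ∈ elements, ∀ T' ∈ elements, T ≠ T' → Disjoint T T'
  cover : volume (Ω \ ⋃ T ∈ elements, T) = 0

/-! ### Symmetric tensors and the material law -/

/-- The space of symmetric matrices inside the `d × d` matrices with the Frobenius inner product. -/
def symSubmodule (d : ℕ) : Submodule ℝ (EuclideanSpace ℝ (Fin d × Fin d)) where
  carrier := {A | ∀ i j, A (i, j) = A (j, i)}
  add_mem' := by
    intro A B hA hB i j
    simp only [PiLp.add_apply]
    rw [hA i j, hB i j]
  zero_mem' := by intro i j; simp
  smul_mem' := by
    intro c A hA i j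
    simp only [PiLp.smul_apply]
    rw [hA i j]

/-- Symmetric `d × d` tensors with the Frobenius inner product. -/
def SymTensor (d : ℕ) : Type := symSubmodule d

instance (d : ℕ) : NormedAddCommGroup (SymTensor d) :=
  inferInstanceAs (NormedAddCommGroup (symSubmodule d))

instance (d : ℕ) : InnerProductSpace ℝ (SymTensor d) :=
  inferInstanceAs (InnerProductSpace ℝ (symSubmodule d))

instance (d : ℕ) : FiniteDimensional ℝ (SymTensor d) :=
  inferInstanceAs (FiniteDimensional ℝ (symSubmodule d))

instance (d : ℕ) : CompleteSpace (SymTensor d) := FiniteDimensional.complete ℝ _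

/-- The `(i, j)` component of a symmetric tensor. -/
def SymTensor.comp {d : ℕ} (i j : Fin d) : SymTensor d →L[ℝ] ℝ :=
  (EuclideanSpace.proj (i, j)).comp (symSubmodule d).subtypeL

/-- The trace of a symmetric tensor. -/
def SymTensor.tr (d : ℕ) : SymTensor d →L[ℝ] ℝ := ∑ i, SymTensor.comp i i

/-- The identity tensor. -/
def SymTensor.one (d : ℕ) : SymTensor d :=
  ⟨WithLp.toLp 2 fun p => if p.1 = p.2 then 1 else 0, by
    intro i j; simp [eq_comm]⟩

/-- The bending rigidity `D = E t³ / (12 (1 - ν²))`. -/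
def bendingRigidity (E t ν : ℝ) : ℝ := E * t ^ 3 / (12 * (1 - ν ^ 2))

/-- The material tensor `𝒞 κ = D (ν tr(κ) I + (1 - ν) κ)`. -/
def matC (d : ℕ) (E t ν : ℝ) : SymTensor d →L[ℝ] SymTensor d :=
  bendingRigidity E t ν •
    (ν • (SymTensor.tr d).smulRight (SymTensor.one d) +
      (1 - ν) • ContinuousLinearMap.id ℝ (SymTensor d))

/-! ### Test functions and weak derivatives -/

/-- `φ ∈ 𝒟(G)`: smooth functions with compact support in `G`. -/
structure IsTest {d : ℕ} (G : Set (Euc d)) (φ : Euc d → ℝ) : Prop where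
  smooth : ContDiff ℝ ∞ φ
  compact : HasCompactSupport φ
  support : tsupport φ ⊆ G

/-- The partial derivative `∂ᵢ φ`. -/
def pd {d : ℕ} (i : Fin d) (φ : Euc d → ℝ) (x : Euc d) : ℝ :=
  fderiv ℝ φ x (EuclideanSpace.single i 1)

/-- `ε∇φ = ½ (∇∇φ + (∇∇φ)ᵀ)`. -/
def symHess {d : ℕ} (φ : Euc d → ℝ) (x : Euc d) : SymTensor d :=
  ⟨WithLp.toLp 2 fun p => (1 / 2 : ℝ) * (pd p.1 (pd p.2 φ) x + pd p.2 (pd p.1 φ) x), by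
    intro i j; simp only [add_comm]⟩

/-- `L₂(Ω)`. -/
abbrev L2 {d : ℕ} (Ω : Set (Euc d)) := Lp ℝ 2 (volume.restrict Ω)

/-- `𝕃₂ˢ(Ω)`, the square integrable symmetric tensor functions. -/
abbrev L2s {d : ℕ} (Ω : Set (Euc d)) := Lp (SymTensor d) 2 (volume.restrict Ω)

/-- For `G ⊆ Ω`: the restriction of `z` to `G` has the weak derivative `ε∇z = H` in `G`.
(The integrands vanish outside `G`.) -/
def IsWeakHess {d : ℕ} (Ω G : Set (Euc d)) (z : L2 Ω) (H : L2s Ω) : Prop :=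
  ∀ φ : Euc d → ℝ, IsTest G φ → ∀ i j : Fin d,
    ∫ x in Ω, z x * SymTensor.comp i j (symHess φ x) = ∫ x in Ω, SymTensor.comp i j (H x) * φ x

/-- For `G ⊆ Ω`: the restriction of `Θ` to `G` has the weak derivative `div div Θ = g` in `G`.
(The integrands vanish outside `G`.) -/
def IsWeakDivDiv {d : ℕ} (Ω G : Set (Euc d)) (Θ : L2s Ω) (g : L2 Ω) : Prop :=
  ∀ φ : Euc d → ℝ, IsTest G φ →
    ∫ x in Ω, ⟪Θ x, symHess φ x⟫_ℝ = ∫ x in Ω, g x * φ x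

section Helpers

variable {d : ℕ}

lemma pd_smooth (i : Fin d) {φ : Euc d → ℝ} (h : ContDiff ℝ ∞ φ) : ContDiff ℝ ∞ (pd i φ) :=
  (h.fderiv_right (m := ∞) le_rfl).clm_apply contDiff_const

lemma pd_compact (i : Fin d) {φ : Euc d → ℝ} (h : HasCompactSupport φ) :
    HasCompactSupport (pd i φ) := h.fderiv_apply ℝ _

lemma symHess_continuous {φ : Euc d → ℝ} (h : ContDiff ℝ ∞ φ) : Continuous (symHess φ) := by
  refine Continuous.subtype_mk ?_ _
  refine (PiLp.continuous_toLp 2 _).comp (continuous_pi fun p => ?_)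
  have h1 := (pd_smooth p.1 (pd_smooth p.2 h)).continuous
  have h2 := (pd_smooth p.2 (pd_smooth p.1 h)).continuous
  fun_prop

lemma symHess_compact {φ : Euc d → ℝ} (h : HasCompactSupport φ) :
    HasCompactSupport (symHess φ) := by
  refine HasCompactSupport.intro h.isCompact (fun x hx => ?_)
  have key : ∀ i j : Fin d, pd i (pd j φ) x = 0 := fun i j => by
    have : x ∉ tsupport (pd i (pd j φ)) := fun hx' => hx
      ((tsupport_fderiv_apply_subset ℝ _).trans (tsupport_fderiv_apply_subset ℝ _) hx')
    exact image_eq_zero_of_notMem_tsupport this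
  refine Subtype.ext (PiLp.ext fun p => ?_)
  change (1 / 2 : ℝ) * (pd p.1 (pd p.2 φ) x + pd p.2 (pd p.1 φ) x) = 0
  simp [key]

/-- Pairing with a continuous function of compact support is continuous on `L₂`. -/
lemma exists_pairing {F : Type*} [NormedAddCommGroup F] [InnerProductSpace ℝ F]
    (Ω : Set (Euc d)) {ψ : Euc d → F}
    (hc : Continuous ψ) (hs : HasCompactSupport ψ) :
    ∃ ℓ : Lp F 2 (volume.restrict Ω) →L[ℝ] ℝ, ∀ z, ∫ x in Ω, ⟪z x, ψ x⟫_ℝ = ℓ z := by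
  have hm : MemLp ψ 2 (volume.restrict Ω) := hc.memLp_of_hasCompactSupport hs
  refine ⟨innerSL ℝ (hm.toLp ψ), fun z => ?_⟩
  rw [innerSL_apply_apply, real_inner_comm, L2.inner_def]
  refine integral_congr_ae ?_
  filter_upwards [hm.coeFn_toLp] with x hx
  rw [hx]

lemma exists_pairing_scalar (Ω : Set (Euc d)) {ψ : Euc d → ℝ}
    (hc : Continuous ψ) (hs : HasCompactSupport ψ) :
    ∃ ℓ : L2 Ω →L[ℝ] ℝ, ∀ z, ∫ x in Ω, z x * ψ x = ℓ z := by
  obtain ⟨ℓ, h⟩ := exists_pairing Ω hc hs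
  refine ⟨ℓ, fun z => ?_⟩
  rw [← h z]
  simp [mul_comm]

lemma exists_pairing_comp (Ω : Set (Euc d)) (i j : Fin d) {ψ : Euc d → ℝ}
    (hc : Continuous ψ) (hs : HasCompactSupport ψ) :
    ∃ ℓ : L2s Ω →L[ℝ] ℝ, ∀ H, ∫ x in Ω, SymTensor.comp i j (H x) * ψ x = ℓ H := by
  obtain ⟨ℓ, h⟩ := exists_pairing_scalar Ω hc hs
  refine ⟨ℓ.comp ((SymTensor.comp i j).compLpL 2 _), fun H => ?_⟩
  rw [ContinuousLinearMap.comp_apply, ← h]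
  refine integral_congr_ae ?_
  filter_upwards [(SymTensor.comp i j).coeFn_compLpL (p := 2) H] with x hx
  rw [hx]

/-- The weak Hessian condition is a family of continuous linear equations. -/
lemma isWeakHess_iff (Ω G : Set (Euc d)) :
    ∃ S : Set (WithLp 2 (L2 Ω × L2s Ω) →L[ℝ] ℝ),
      ∀ p : WithLp 2 (L2 Ω × L2s Ω), IsWeakHess Ω G p.fst p.snd ↔ ∀ ℓ ∈ S, ℓ p = 0 := by
  have h : ∀ (φ : Euc d → ℝ) (i j : Fin d), ∃ ℓ : WithLp 2 (L2 Ω × L2s Ω) →L[ℝ] ℝ,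
      IsTest G φ → ∀ p, ℓ p = (∫ x in Ω, p.fst x * SymTensor.comp i j (symHess φ x))
        - ∫ x in Ω, SymTensor.comp i j (p.snd x) * φ x := by
    intro φ i j
    by_cases hφ : IsTest G φ
    · obtain ⟨a, ha⟩ := exists_pairing_scalar Ω
        ((SymTensor.comp i j).continuous.comp (symHess_continuous hφ.smooth))
        ((symHess_compact hφ.compact).comp_left (map_zero (SymTensor.comp i j)))
      obtain ⟨b, hb⟩ := exists_pairing_comp Ω i j hφ.smooth.continuous hφ.compact
      refine ⟨a.comp (WithLp.fstL 2 ℝ _ _) - b.comp (WithLp.sndL 2 ℝ _ _), fun _ p => ?_⟩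
      have h1 := ha p.fst
      have h2 := hb p.snd
      simp only [Function.comp_apply] at h1
      rw [h1, h2]
      rfl
    · exact ⟨0, fun h => absurd h hφ⟩
  choose ℓ hℓ using h
  refine ⟨{m | ∃ φ i j, IsTest G φ ∧ m = ℓ φ i j}, fun p => ⟨?_, ?_⟩⟩
  · rintro hp _ ⟨φ, i, j, hφ, rfl⟩
    rw [hℓ φ i j hφ, hp φ hφ i j, sub_self]
  · intro hp φ hφ i j
    have := hp _ ⟨φ, i, j, hφ, rfl⟩
    rw [hℓ φ i j hφ] at this
    exact sub_eq_zero.1 this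

/-- The weak `div div` condition is a family of continuous linear equations. -/
lemma isWeakDivDiv_iff (Ω G : Set (Euc d)) :
    ∃ S : Set (WithLp 2 (L2s Ω × L2 Ω) →L[ℝ] ℝ),
      ∀ p : WithLp 2 (L2s Ω × L2 Ω), IsWeakDivDiv Ω G p.fst p.snd ↔ ∀ ℓ ∈ S, ℓ p = 0 := by
  have h : ∀ φ : Euc d → ℝ, ∃ ℓ : WithLp 2 (L2s Ω × L2 Ω) →L[ℝ] ℝ,
      IsTest G φ → ∀ p, ℓ p = (∫ x in Ω, ⟪p.fst x, symHess φ x⟫_ℝ)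
        - ∫ x in Ω, p.snd x * φ x := by
    intro φ
    by_cases hφ : IsTest G φ
    · obtain ⟨a, ha⟩ := exists_pairing Ω (symHess_continuous hφ.smooth)
        (symHess_compact hφ.compact)
      obtain ⟨b, hb⟩ := exists_pairing_scalar Ω hφ.smooth.continuous hφ.compact
      refine ⟨a.comp (WithLp.fstL 2 ℝ _ _) - b.comp (WithLp.sndL 2 ℝ _ _), fun _ p => ?_⟩
      rw [ha, hb]
      rfl
    · exact ⟨0, fun h => absurd h hφ⟩
  choose ℓ hℓ using h
  refine ⟨{m | ∃ φ, IsTest G φ ∧ m = ℓ φ}, fun p => ⟨?_, ?_⟩⟩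
  · rintro hp _ ⟨φ, hφ, rfl⟩
    rw [hℓ φ hφ, hp φ hφ, sub_self]
  · intro hp φ hφ
    have := hp _ ⟨φ, hφ, rfl⟩
    rw [hℓ φ hφ] at this
    exact sub_eq_zero.1 this

end Helpers

/-! ### Function spaces

Elements of the graph spaces are pairs `(z, ε∇z)` and `(Θ, div div Θ)`; the derivative is
determined by the function, and the norm of the pair is the graph norm. -/

/-- Pairs `(z, H)` in `L₂(Ω) × 𝕃₂ˢ(Ω)` such that `H = ε∇z` weakly in `G ⊆ Ω`. -/
def weakHessOn {d : ℕ} (Ω G : Set (Euc d)) : Submodule ℝ (WithLp 2 (L2 Ω × L2s Ω)) where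
  carrier := {p | IsWeakHess Ω G p.fst p.snd}
  add_mem' := by
    obtain ⟨S, hS⟩ := isWeakHess_iff Ω G
    intro p q hp hq
    simp only [mem_ofPred_eq, hS] at hp hq ⊢
    intro ℓ hℓ
    rw [map_add, hp ℓ hℓ, hq ℓ hℓ, add_zero]
  zero_mem' := by
    obtain ⟨S, hS⟩ := isWeakHess_iff Ω G
    simp only [mem_ofPred_eq, hS]
    intro ℓ _
    exact map_zero ℓ
  smul_mem' := by
    obtain ⟨S, hS⟩ := isWeakHess_iff Ω G
    intro c p hp
    simp only [mem_ofPred_eq, hS] at hp ⊢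
    intro ℓ hℓ
    rw [map_smul, hp ℓ hℓ, smul_zero]

/-- Pairs `(Θ, g)` in `𝕃₂ˢ(Ω) × L₂(Ω)` such that `g = div div Θ` weakly in `G ⊆ Ω`. -/
def weakDivDivOn {d : ℕ} (Ω G : Set (Euc d)) : Submodule ℝ (WithLp 2 (L2s Ω × L2 Ω)) where
  carrier := {p | IsWeakDivDiv Ω G p.fst p.snd}
  add_mem' := by
    obtain ⟨S, hS⟩ := isWeakDivDiv_iff Ω G
    intro p q hp hq
    simp only [mem_ofPred_eq, hS] at hp hq ⊢
    intro ℓ hℓ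
    rw [map_add, hp ℓ hℓ, hq ℓ hℓ, add_zero]
  zero_mem' := by
    obtain ⟨S, hS⟩ := isWeakDivDiv_iff Ω G
    simp only [mem_ofPred_eq, hS]
    intro ℓ _
    exact map_zero ℓ
  smul_mem' := by
    obtain ⟨S, hS⟩ := isWeakDivDiv_iff Ω G
    intro c p hp
    simp only [mem_ofPred_eq, hS] at hp ⊢
    intro ℓ hℓ
    rw [map_smul, hp ℓ hℓ, smul_zero]

lemma weakHessOn_isClosed {d : ℕ} (Ω G : Set (Euc d)) :
    IsClosed (weakHessOn Ω G : Set (WithLp 2 (L2 Ω × L2s Ω))) := by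
  obtain ⟨S, hS⟩ := isWeakHess_iff Ω G
  have : (weakHessOn Ω G : Set (WithLp 2 (L2 Ω × L2s Ω))) = ⋂ ℓ ∈ S, {p | ℓ p = 0} := by
    ext p
    simp only [mem_iInter, mem_ofPred_eq]
    exact hS p
  rw [this]
  exact isClosed_biInter fun ℓ _ => isClosed_eq ℓ.continuous continuous_const

lemma weakDivDivOn_isClosed {d : ℕ} (Ω G : Set (Euc d)) :
    IsClosed (weakDivDivOn Ω G : Set (WithLp 2 (L2s Ω × L2 Ω))) := by
  obtain ⟨S, hS⟩ := isWeakDivDiv_iff Ω G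
  have : (weakDivDivOn Ω G : Set (WithLp 2 (L2s Ω × L2 Ω))) = ⋂ ℓ ∈ S, {p | ℓ p = 0} := by
    ext p
    simp only [mem_iInter, mem_ofPred_eq]
    exact hS p
  rw [this]
  exact isClosed_biInter fun ℓ _ => isClosed_eq ℓ.continuous continuous_const

/-- `H²₀(Ω)` as a space of pairs: the closure of `𝒟(Ω)` in the norm `(‖z‖² + ‖ε∇z‖²)^{1/2}`. -/
def h20Sub {d : ℕ} (Ω : Set (Euc d)) : Submodule ℝ (WithLp 2 (L2 Ω × L2s Ω)) :=
  (Submodule.span ℝ {p : WithLp 2 (L2 Ω × L2s Ω) | ∃ φ : Euc d → ℝ, IsTest Ω φ ∧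
    (p.fst : Euc d → ℝ) =ᵐ[volume.restrict Ω] φ ∧
    (p.snd : Euc d → SymTensor d) =ᵐ[volume.restrict Ω] symHess φ}).topologicalClosure

/-- `H²(𝒯)` as a space of pairs `(z, ε_𝒯∇_𝒯 z)`. -/
def h2BrSub {d : ℕ} {Ω : Set (Euc d)} (𝒯 : Mesh Ω) : Submodule ℝ (WithLp 2 (L2 Ω × L2s Ω)) :=
  ⨅ T ∈ 𝒯.elements, weakHessOn Ω T

/-- `H(div div, 𝒯)` as a space of pairs `(Θ, div_𝒯 div_𝒯 Θ)`. -/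
def hddBrSub {d : ℕ} {Ω : Set (Euc d)} (𝒯 : Mesh Ω) : Submodule ℝ (WithLp 2 (L2s Ω × L2 Ω)) :=
  ⨅ T ∈ 𝒯.elements, weakDivDivOn Ω T

section Spaces

variable {d : ℕ}

/-- `H²₀(Ω)`. -/
def H20 (Ω : Set (Euc d)) : Type := h20Sub Ω

instance (Ω : Set (Euc d)) : NormedAddCommGroup (H20 Ω) :=
  inferInstanceAs (NormedAddCommGroup (h20Sub Ω))

instance (Ω : Set (Euc d)) : InnerProductSpace ℝ (H20 Ω) :=
  inferInstanceAs (InnerProductSpace ℝ (h20Sub Ω))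

/-- `H(div div, Ω)`. -/
def HDD (Ω : Set (Euc d)) : Type := weakDivDivOn Ω Ω

instance (Ω : Set (Euc d)) : NormedAddCommGroup (HDD Ω) :=
  inferInstanceAs (NormedAddCommGroup (weakDivDivOn Ω Ω))

instance (Ω : Set (Euc d)) : InnerProductSpace ℝ (HDD Ω) :=
  inferInstanceAs (InnerProductSpace ℝ (weakDivDivOn Ω Ω))

variable {Ω : Set (Euc d)}

/-- The broken space `H²(𝒯)`. -/
def H2Br (𝒯 : Mesh Ω) : Type := h2BrSub 𝒯

instance (𝒯 : Mesh Ω) : NormedAddCommGroup (H2Br 𝒯) :=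
  inferInstanceAs (NormedAddCommGroup (h2BrSub 𝒯))

instance (𝒯 : Mesh Ω) : InnerProductSpace ℝ (H2Br 𝒯) :=
  inferInstanceAs (InnerProductSpace ℝ (h2BrSub 𝒯))

instance (𝒯 : Mesh Ω) : CompleteSpace (H2Br 𝒯) := by
  have h : IsClosed (h2BrSub 𝒯 : Set (WithLp 2 (L2 Ω × L2s Ω))) := by
    simp only [h2BrSub, Submodule.coe_iInf]
    exact isClosed_biInter fun T _ => weakHessOn_isClosed Ω T
  exact h.completeSpace_coe

/-- The broken space `H(div div, 𝒯)`. -/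
def HDDBr (𝒯 : Mesh Ω) : Type := hddBrSub 𝒯

instance (𝒯 : Mesh Ω) : NormedAddCommGroup (HDDBr 𝒯) :=
  inferInstanceAs (NormedAddCommGroup (hddBrSub 𝒯))

instance (𝒯 : Mesh Ω) : InnerProductSpace ℝ (HDDBr 𝒯) :=
  inferInstanceAs (InnerProductSpace ℝ (hddBrSub 𝒯))

instance (𝒯 : Mesh Ω) : CompleteSpace (HDDBr 𝒯) := by
  have h : IsClosed (hddBrSub 𝒯 : Set (WithLp 2 (L2s Ω × L2 Ω))) := by
    simp only [hddBrSub, Submodule.coe_iInf]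
    exact isClosed_biInter fun T _ => weakDivDivOn_isClosed Ω T
  exact h.completeSpace_coe

/-- The function `z` of `z ∈ H²₀(Ω)`. -/
def H20.fn : H20 Ω →L[ℝ] L2 Ω := (WithLp.fstL 2 ℝ _ _).comp (h20Sub Ω).subtypeL

/-- The derivative `ε∇z` of `z ∈ H²₀(Ω)`. -/
def H20.hess : H20 Ω →L[ℝ] L2s Ω := (WithLp.sndL 2 ℝ _ _).comp (h20Sub Ω).subtypeL

/-- The function `Θ` of `Θ ∈ H(div div, Ω)`. -/
def HDD.fn : HDD Ω →L[ℝ] L2s Ω := (WithLp.fstL 2 ℝ _ _).comp (weakDivDivOn Ω Ω).subtypeL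

/-- The derivative `div div Θ` of `Θ ∈ H(div div, Ω)`. -/
def HDD.divdiv : HDD Ω →L[ℝ] L2 Ω := (WithLp.sndL 2 ℝ _ _).comp (weakDivDivOn Ω Ω).subtypeL

/-- The function `z` of `z ∈ H²(𝒯)`. -/
def H2Br.fn {𝒯 : Mesh Ω} : H2Br 𝒯 →L[ℝ] L2 Ω := (WithLp.fstL 2 ℝ _ _).comp (h2BrSub 𝒯).subtypeL

/-- The piecewise derivative `ε_𝒯∇_𝒯 z` of `z ∈ H²(𝒯)`. -/
def H2Br.hess {𝒯 : Mesh Ω} : H2Br 𝒯 →L[ℝ] L2s Ω :=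
  (WithLp.sndL 2 ℝ _ _).comp (h2BrSub 𝒯).subtypeL

/-- The function `Θ` of `Θ ∈ H(div div, 𝒯)`. -/
def HDDBr.fn {𝒯 : Mesh Ω} : HDDBr 𝒯 →L[ℝ] L2s Ω :=
  (WithLp.fstL 2 ℝ _ _).comp (hddBrSub 𝒯).subtypeL

/-- The piecewise derivative `div_𝒯 div_𝒯 Θ` of `Θ ∈ H(div div, 𝒯)`. -/
def HDDBr.divdiv {𝒯 : Mesh Ω} : HDDBr 𝒯 →L[ℝ] L2 Ω :=
  (WithLp.sndL 2 ℝ _ _).comp (hddBrSub 𝒯).subtypeL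

end Spaces

/-! ### Traces -/

section Traces

variable {d : ℕ} {Ω : Set (Euc d)}

section ElementInner

variable {F : Type*} [NormedAddCommGroup F] [InnerProductSpace ℝ F]

/-- The inner product `(u, v)_T = ∫_T u · v` for `T ⊆ Ω`. -/
def elementInner (T : Set (Euc d)) (u v : Lp F 2 (volume.restrict Ω)) : ℝ :=
  ∫ x in T, ⟪u x, v x⟫_ℝ ∂(volume.restrict Ω)

lemma elementInner_eq (T : Set (Euc d)) (u v : Lp F 2 (volume.restrict Ω)) :
    elementInner T u v =
      ⟪LpToLpRestrictCLM (Euc d) F ℝ (volume.restrict Ω) 2 T u,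
        LpToLpRestrictCLM (Euc d) F ℝ (volume.restrict Ω) 2 T v⟫_ℝ := by
  rw [L2.inner_def, elementInner]
  refine integral_congr_ae ?_
  filter_upwards [LpToLpRestrictCLM_coeFn ℝ (μ := volume.restrict Ω) (p := 2) T u,
    LpToLpRestrictCLM_coeFn ℝ (μ := volume.restrict Ω) (p := 2) T v] with x hu hv
  rw [hu, hv]

lemma elementInner_add_left (T : Set (Euc d)) (u u' v : Lp F 2 (volume.restrict Ω)) :
    elementInner T (u + u') v = elementInner T u v + elementInner T u' v := by
  simp only [elementInner_eq, map_add, inner_add_left]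

lemma elementInner_add_right (T : Set (Euc d)) (u v v' : Lp F 2 (volume.restrict Ω)) :
    elementInner T u (v + v') = elementInner T u v + elementInner T u v' := by
  simp only [elementInner_eq, map_add, inner_add_right]

lemma elementInner_smul_left (T : Set (Euc d)) (c : ℝ) (u v : Lp F 2 (volume.restrict Ω)) :
    elementInner T (c • u) v = c * elementInner T u v := by
  simp only [elementInner_eq, map_smul, real_inner_smul_left]

lemma elementInner_smul_right (T : Set (Euc d)) (c : ℝ) (u v : Lp F 2 (volume.restrict Ω)) :
    elementInner T u (c • v) = c * elementInner T u v := by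
  simp only [elementInner_eq, map_smul, real_inner_smul_right]

lemma elementInner_continuous_left (T : Set (Euc d)) (v : Lp F 2 (volume.restrict Ω)) :
    Continuous fun u => elementInner T u v := by
  simp only [elementInner_eq]
  exact (ContinuousLinearMap.continuous _).inner continuous_const

lemma elementInner_continuous_right (T : Set (Euc d)) (u : Lp F 2 (volume.restrict Ω)) :
    Continuous fun v => elementInner T u v := by
  simp only [elementInner_eq]
  exact continuous_const.inner (ContinuousLinearMap.continuous _)

end ElementInner

/-- The trace operator `tr^{dDiv} : H(div div, Ω) → H²(𝒯)'`,
`⟨tr^{dDiv}(Θ), z⟩_𝒮 = ∑_T ((div div Θ, z)_T - (Θ, ε∇z)_T)`. -/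
def trDD (𝒯 : Mesh Ω) : HDD Ω →ₗ[ℝ] StrongDual ℝ (H2Br 𝒯) where
  toFun Θ :=
    { toFun := fun z =>
        ∑ T ∈ 𝒯.elements, (elementInner T Θ.divdiv z.fn - elementInner T Θ.fn z.hess)
      map_add' := fun z z' => by
        rw [← Finset.sum_add_distrib]
        refine Finset.sum_congr rfl fun T _ => ?_
        simp only [map_add, elementInner_add_right]
        ring
      map_smul' := fun c z => by
        rw [RingHom.id_apply, smul_eq_mul, Finset.mul_sum]
        refine Finset.sum_congr rfl fun T _ => ?_
        simp only [map_smul, elementInner_smul_right]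
        ring
      cont := continuous_finsetSum _ fun T _ =>
        ((elementInner_continuous_right T _).comp H2Br.fn.continuous).sub
          ((elementInner_continuous_right T _).comp H2Br.hess.continuous) }
  map_add' Θ Θ' := by
    ext z
    change Finset.sum (M := ℝ) 𝒯.elements _ =
      Finset.sum 𝒯.elements _ + Finset.sum 𝒯.elements _
    rw [← Finset.sum_add_distrib]
    refine Finset.sum_congr rfl fun T _ => ?_
    simp only [map_add, elementInner_add_left]
    ring
  map_smul' c Θ := by
    ext z
    change Finset.sum (M := ℝ) 𝒯.elements _ = c * Finset.sum 𝒯.elements _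
    rw [Finset.mul_sum]
    refine Finset.sum_congr rfl fun T _ => ?_
    simp only [map_smul, elementInner_smul_left]
    ring

/-- The trace operator `tr^{gGrad} : H²₀(Ω) → H(div div, 𝒯)'`,
`⟨tr^{gGrad}(z), Θ⟩_𝒮 = ∑_T ((div div Θ, z)_T - (Θ, ε∇z)_T)`. -/
def trGG (𝒯 : Mesh Ω) : H20 Ω →ₗ[ℝ] StrongDual ℝ (HDDBr 𝒯) where
  toFun z :=
    { toFun := fun Θ =>
        ∑ T ∈ 𝒯.elements, (elementInner T Θ.divdiv z.fn - elementInner T Θ.fn z.hess)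
      map_add' := fun Θ Θ' => by
        rw [← Finset.sum_add_distrib]
        refine Finset.sum_congr rfl fun T _ => ?_
        simp only [map_add, elementInner_add_left]
        ring
      map_smul' := fun c Θ => by
        rw [RingHom.id_apply, smul_eq_mul, Finset.mul_sum]
        refine Finset.sum_congr rfl fun T _ => ?_
        simp only [map_smul, elementInner_smul_left]
        ring
      cont := continuous_finsetSum _ fun T _ =>
        ((elementInner_continuous_left T _).comp HDDBr.divdiv.continuous).sub
          ((elementInner_continuous_left T _).comp HDDBr.fn.continuous) }
  map_add' z z' := by
    ext Θ
    change Finset.sum (M := ℝ) 𝒯.elements _ =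
      Finset.sum 𝒯.elements _ + Finset.sum 𝒯.elements _
    rw [← Finset.sum_add_distrib]
    refine Finset.sum_congr rfl fun T _ => ?_
    simp only [map_add, elementInner_add_right]
    ring
  map_smul' c z := by
    ext Θ
    change Finset.sum (M := ℝ) 𝒯.elements _ = c * Finset.sum 𝒯.elements _
    rw [Finset.mul_sum]
    refine Finset.sum_congr rfl fun T _ => ?_
    simp only [map_smul, elementInner_smul_right]
    ring

/-- `𝐇^{-3/2,-1/2}(𝒮)`, the range of `tr^{dDiv}`. -/
def TraceDD (𝒯 : Mesh Ω) : Type := LinearMap.range (trDD 𝒯)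

/-- The norm of `𝐇^{-3/2,-1/2}(𝒮)` is the dual norm of `H²(𝒯)'`. -/
instance (𝒯 : Mesh Ω) : NormedAddCommGroup (TraceDD 𝒯) :=
  inferInstanceAs (NormedAddCommGroup (LinearMap.range (trDD 𝒯)))

instance (𝒯 : Mesh Ω) : NormedSpace ℝ (TraceDD 𝒯) :=
  inferInstanceAs (NormedSpace ℝ (LinearMap.range (trDD 𝒯)))

/-- The functional `⟨q, ·⟩_𝒮` of `q ∈ 𝐇^{-3/2,-1/2}(𝒮)`. -/
def TraceDD.pairing {𝒯 : Mesh Ω} : TraceDD 𝒯 →L[ℝ] StrongDual ℝ (H2Br 𝒯) :=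
  (LinearMap.range (trDD 𝒯)).subtypeL

/-- `𝐇^{3/2,1/2}_{00}(𝒮)`, the range of `tr^{gGrad}`. -/
def TraceGG (𝒯 : Mesh Ω) : Type := LinearMap.range (trGG 𝒯)

/-- The norm of `𝐇^{3/2,1/2}_{00}(𝒮)` is the dual norm of `H(div div, 𝒯)'`. -/
instance (𝒯 : Mesh Ω) : NormedAddCommGroup (TraceGG 𝒯) :=
  inferInstanceAs (NormedAddCommGroup (LinearMap.range (trGG 𝒯)))

instance (𝒯 : Mesh Ω) : NormedSpace ℝ (TraceGG 𝒯) :=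
  inferInstanceAs (NormedSpace ℝ (LinearMap.range (trGG 𝒯)))

/-- The functional `⟨v, ·⟩_𝒮` of `v ∈ 𝐇^{3/2,1/2}_{00}(𝒮)`. -/
def TraceGG.pairing {𝒯 : Mesh Ω} : TraceGG 𝒯 →L[ℝ] StrongDual ℝ (HDDBr 𝒯) :=
  (LinearMap.range (trGG 𝒯)).subtypeL

end Traces

/-! ### The ultraweak formulation and the DPG method -/

section Formulation

variable {d : ℕ} {Ω : Set (Euc d)}

/-- `𝒰 = L₂(Ω) × 𝕃₂ˢ(Ω) × 𝐇^{3/2,1/2}_{00}(𝒮) × 𝐇^{-3/2,-1/2}(𝒮)` with the product norm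
`(‖u‖² + ‖M‖² + ‖û‖² + ‖q̂‖²)^{1/2}`. -/
abbrev TrialSpace (𝒯 : Mesh Ω) :=
  WithLp 2 (WithLp 2 (L2 Ω × L2s Ω) × WithLp 2 (TraceGG 𝒯 × TraceDD 𝒯))

/-- `𝒱 = H²(𝒯) × H(div div, 𝒯)` with the product inner product. -/
abbrev TestSpace (𝒯 : Mesh Ω) := WithLp 2 (H2Br 𝒯 × HDDBr 𝒯)

/-- The inverse material tensor `𝒞⁻¹`, acting pointwise on `𝕃₂ˢ(Ω)`. -/
def matCInv (E t ν : ℝ) : L2s Ω →L[ℝ] L2s Ω :=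
  (matC d E t ν).inverse.compLpL 2 (volume.restrict Ω)

/-- The bilinear form
`b(u, M, û, q̂; z, Θ) = (M, ε_𝒯∇_𝒯 z + 𝒞⁻¹Θ) + (u, div_𝒯 div_𝒯 Θ) + ⟨q̂, z⟩_𝒮 - ⟨û, Θ⟩_𝒮`,
for a trial function `u = ((u, M), (û, q̂))` and a test function `v = (z, Θ)`. -/
def bForm (E t ν : ℝ) (𝒯 : Mesh Ω) (u : TrialSpace 𝒯) (v : TestSpace 𝒯) : ℝ :=
  ⟪u.fst.snd, v.fst.hess + matCInv E t ν v.snd.fn⟫_ℝ + ⟪u.fst.fst, v.snd.divdiv⟫_ℝ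
    + u.snd.snd.pairing v.fst - u.snd.fst.pairing v.snd

/-- The load functional `L(z, Θ) = -(f, z)`. -/
def load (𝒯 : Mesh Ω) (f : L2 Ω) (v : TestSpace 𝒯) : ℝ := -⟪f, v.fst.fn⟫_ℝ

/-- The operator `B : 𝒰 → 𝒱'` induced by `b`. -/
def opB (E t ν : ℝ) (𝒯 : Mesh Ω) (u : TrialSpace 𝒯) : StrongDual ℝ (TestSpace 𝒯) where
  toFun := bForm E t ν 𝒯 u
  map_add' v w := by
    simp only [bForm, WithLp.add_fst, WithLp.add_snd, map_add, inner_add_right]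
    ring
  map_smul' c v := by
    simp only [bForm, WithLp.smul_fst, WithLp.smul_snd, map_smul,
      inner_add_right, real_inner_smul_right, smul_eq_mul, RingHom.id_apply]
    ring
  cont := by
    have h1 : Continuous fun v : TestSpace 𝒯 => v.fst :=
      continuous_fst.comp (WithLp.prod_continuous_ofLp 2 _ _)
    have h2 : Continuous fun v : TestSpace 𝒯 => v.snd :=
      continuous_snd.comp (WithLp.prod_continuous_ofLp 2 _ _)
    refine Continuous.sub (Continuous.add (Continuous.add ?_ ?_) ?_) ?_
    · exact continuous_const.inner ((H2Br.hess.continuous.comp h1).add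
        ((matCInv E t ν).continuous.comp (HDDBr.fn.continuous.comp h2)))
    · exact continuous_const.inner (HDDBr.divdiv.continuous.comp h2)
    · exact (TraceDD.pairing u.snd.snd).continuous.comp h1
    · exact (TraceGG.pairing u.snd.fst).continuous.comp h2

/-- The energy norm `‖B u‖_{𝒱'}`. -/
def energyNorm (E t ν : ℝ) (𝒯 : Mesh Ω) (u : TrialSpace 𝒯) : ℝ := ‖opB E t ν 𝒯 u‖

/-- The trial-to-test operator: the Riesz representative `T u ∈ 𝒱` of `b(u, ·)`. -/
def trialToTest (E t ν : ℝ) (𝒯 : Mesh Ω) (u : TrialSpace 𝒯) : TestSpace 𝒯 :=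
  (InnerProductSpace.toDual ℝ (TestSpace 𝒯)).symm (opB E t ν 𝒯 u)

/-- The defining property `(T u, v)_𝒱 = b(u, v)` of the trial-to-test operator. -/
lemma inner_trialToTest (E t ν : ℝ) (𝒯 : Mesh Ω) (u : TrialSpace 𝒯) (v : TestSpace 𝒯) :
    ⟪trialToTest E t ν 𝒯 u, v⟫_ℝ = bForm E t ν 𝒯 u v := by
  rw [trialToTest, InnerProductSpace.toDual_symm_apply]
  rfl

/-- `u` solves the ultraweak formulation with load `f`. -/
def IsUltraweakSolution (E t ν : ℝ) (𝒯 : Mesh Ω) (f : L2 Ω) (u : TrialSpace 𝒯) : Prop :=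
  ∀ v : TestSpace 𝒯, bForm E t ν 𝒯 u v = load 𝒯 f v

/-- `u_h ∈ 𝒰_h` solves the DPG scheme with optimal test functions. -/
def IsDPGSolution (E t ν : ℝ) (𝒯 : Mesh Ω) (f : L2 Ω) (Uh : Submodule ℝ (TrialSpace 𝒯))
    (uh : TrialSpace 𝒯) : Prop :=
  uh ∈ Uh ∧ ∀ w ∈ Uh,
    bForm E t ν 𝒯 uh (trialToTest E t ν 𝒯 w) = load 𝒯 f (trialToTest E t ν 𝒯 w)

end Formulation

end Plate

end

/-!
`B` is bounded, independently of the mesh (`energyNorm_le`), because both skeleton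
spaces carry the dual norm. That `B` is bounded below, uniformly in the mesh, is the heart of the
matter (`exists_norm_le_energyNorm`). Test functions `(z, Θ) ∈ H²₀(Ω) × H(div div, Ω)` annihilate
the skeleton terms: `H(div div, Ω)` is by definition the domain of the adjoint of the Hessian on
`𝒟(Ω)`, so that `(div div Θ, z) = (Θ, ε∇z)` for all such pairs (`inner_hess_eq_inner_divdiv`). For
these `b(𝐮, 𝐯) = (M, ε∇z + 𝒞⁻¹Θ) + (u, div div Θ)`, and choosing `(z, Θ)` to solve the adjoint
problem `ε∇z + 𝒞⁻¹Θ = M`, `div div Θ = u` (`exists_adjoint_solution`) bounds `‖u‖² + ‖M‖²` by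
`‖B𝐮‖` times the norm of `(z, Θ)`, hence by a multiple of `‖B𝐮‖ (‖u‖² + ‖M‖²)^{1/2}`. No mesh
enters here. The dual norms of `q̂` and `û` are then read off from `b(𝐮, (z, 0))` and
`b(𝐮, (0, Θ))` for arbitrary broken `z` and `Θ`.

The adjoint problem and the existence of a solution both reduce to the plate problem
`(𝒞 ε∇z, ε∇φ) = F(φ)` in `H²₀(Ω)` (`exists_plate_solution`), that is, to the Lax–Milgram lemma and
the Poincaré inequality `‖z‖ ≤ c ‖ε∇z‖` on the bounded set `Ω` (`exists_poincare`): if `z` solves it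
with `F = (f, ·)`, then `z`, `-𝒞 ε∇z` and their traces solve the ultraweak formulation.

Finally `‖T𝐰‖ = ‖B𝐰‖`, and `b(·, T𝐰) = (T ·, T𝐰)` is an inner product on `𝒰`. The discrete problem
is the orthogonal projection of `T𝐮` onto `T(𝒰_h)` (`exists_least_squares`), so it has a unique
solution, which is the best approximation in the energy norm and quasi-optimal in that of `𝒰`.
-/

namespace Plate

noncomputable section

variable {d : ℕ} {Ω : Set (Euc d)}

/-! ### Test functions and the Poincaré inequality -/

lemma IsTest.pd {G : Set (Euc d)} {φ : Euc d → ℝ} (h : IsTest G φ) (i : Fin d) :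
    IsTest G (pd i φ) :=
  ⟨pd_smooth i h.smooth, pd_compact i h.compact,
    (tsupport_fderiv_apply_subset ℝ _).trans h.support⟩

lemma IsTest.mono {G G' : Set (Euc d)} {φ : Euc d → ℝ} (h : IsTest G φ) (hG : G ⊆ G') :
    IsTest G' φ :=
  ⟨h.smooth, h.compact, h.support.trans hG⟩

lemma IsTest.eq_zero {G : Set (Euc d)} {φ : Euc d → ℝ} (h : IsTest G φ) {x : Euc d}
    (hx : x ∉ G) : φ x = 0 :=
  image_eq_zero_of_notMem_tsupport fun hx' => hx (h.support hx')

lemma integral_mul_pd {f g : Euc d → ℝ} (hf : ContDiff ℝ ∞ f) (hg : ContDiff ℝ ∞ g)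
    (hgs : HasCompactSupport g) (i : Fin d) :
    ∫ x, f x * pd i g x = -∫ x, pd i f x * g x := by
  refine integral_mul_fderiv_eq_neg_fderiv_mul_of_integrable ?_ ?_ ?_
    (fun x _ => hf.differentiable (by simp) x) (fun x _ => hg.differentiable (by simp) x)
  · exact ((pd_smooth i hf).continuous.mul hg.continuous).integrable_of_hasCompactSupport
      hgs.mul_left
  · exact (hf.continuous.mul (pd_smooth i hg).continuous).integrable_of_hasCompactSupport
      (pd_compact i hgs).mul_left
  · exact (hf.continuous.mul hg.continuous).integrable_of_hasCompactSupport hgs.mul_left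

lemma integral_mul_pd_pd {f g : Euc d → ℝ} (hf : ContDiff ℝ ∞ f) (hg : ContDiff ℝ ∞ g)
    (hgs : HasCompactSupport g) (i j : Fin d) :
    ∫ x, f x * pd i (pd j g) x = ∫ x, pd j (pd i f) x * g x := by
  rw [integral_mul_pd hf (pd_smooth j hg) (pd_compact j hgs),
    integral_mul_pd (pd_smooth i hf) hg hgs, neg_neg]

lemma comp_symHess (φ : Euc d → ℝ) (x : Euc d) (i j : Fin d) :
    SymTensor.comp i j (symHess φ x) = (1 / 2 : ℝ) * (pd i (pd j φ) x + pd j (pd i φ) x) := rfl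

lemma integral_mul_comp_symHess {f g : Euc d → ℝ} (hf : ContDiff ℝ ∞ f) (hg : ContDiff ℝ ∞ g)
    (hgs : HasCompactSupport g) (i j : Fin d) :
    ∫ x, f x * SymTensor.comp i j (symHess g x) =
      ∫ x, SymTensor.comp i j (symHess f x) * g x := by
  have hI : ∀ {a b : Euc d → ℝ}, ContDiff ℝ ∞ a → ContDiff ℝ ∞ b → HasCompactSupport b →
      Integrable (fun x => a x * b x) := fun ha hb hbs =>
    (ha.continuous.mul hb.continuous).integrable_of_hasCompactSupport hbs.mul_left
  have hg2 := fun i j => pd_smooth i (pd_smooth j hg)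
  have hf2 := fun i j => pd_smooth i (pd_smooth j hf)
  have hgs2 := fun i j => pd_compact i (pd_compact j hgs)
  have h1 : ∀ x, f x * SymTensor.comp i j (symHess g x) =
      (1 / 2 : ℝ) * (f x * pd i (pd j g) x + f x * pd j (pd i g) x) := fun x => by
    rw [comp_symHess]; ring
  have h2 : ∀ x, SymTensor.comp i j (symHess f x) * g x =
      (1 / 2 : ℝ) * (pd i (pd j f) x * g x + pd j (pd i f) x * g x) := fun x => by
    rw [comp_symHess]; ring
  simp only [h1, h2, integral_const_mul]
  rw [integral_add (hI hf (hg2 i j) (hgs2 i j)) (hI hf (hg2 j i) (hgs2 j i)),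
    integral_add (hI (hf2 i j) hg hgs) (hI (hf2 j i) hg hgs),
    integral_mul_pd_pd hf hg hgs, integral_mul_pd_pd hf hg hgs, add_comm]

lemma IsTest.integrable_sq {G : Set (Euc d)} {φ : Euc d → ℝ} (h : IsTest G φ) :
    Integrable fun x => φ x ^ 2 := by
  have hc : Continuous fun x => φ x ^ 2 := h.smooth.continuous.pow 2
  have hs : HasCompactSupport fun x => φ x ^ 2 := h.compact.comp_left (g := (· ^ 2)) (by simp)
  exact hc.integrable_of_hasCompactSupport hs

lemma neg_mul_le_young {s a b R : ℝ} (hs : |s| ≤ R) :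
    -(s * (2 * a * b)) ≤ (1 / 2 : ℝ) * a ^ 2 + 2 * R ^ 2 * b ^ 2 := by
  have h1 : s ^ 2 ≤ R ^ 2 := sq_le_sq.2 (hs.trans (le_abs_self R))
  have h2 := mul_le_mul_of_nonneg_right h1 (sq_nonneg b)
  linarith [sq_nonneg (a + 2 * (s * b)),
    show (a + 2 * (s * b)) ^ 2 = a ^ 2 + 4 * (s * a * b) + 4 * (s ^ 2 * b ^ 2) by ring]

/-- One-directional Poincaré inequality. Integration by parts gives `∫ ψ² = -∫ 2 xᵢ ψ ∂ᵢψ`, and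
the right-hand side is estimated by Young's inequality. -/
lemma integral_sq_le_integral_pd_sq {G : Set (Euc d)} {R : ℝ} (i : Fin d)
    (hR : ∀ x ∈ G, |x i| ≤ R) {ψ : Euc d → ℝ} (h : IsTest G ψ) :
    ∫ x, ψ x ^ 2 ≤ (2 * R) ^ 2 * ∫ x, pd i ψ x ^ 2 := by
  have hx : ContDiff ℝ ∞ fun x : Euc d => x i := (EuclideanSpace.proj (𝕜 := ℝ) i).contDiff
  have hpx : ∀ x : Euc d, pd i (fun x : Euc d => x i) x = 1 := fun x => by
    change fderiv ℝ (EuclideanSpace.proj (𝕜 := ℝ) i) x _ = 1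
    rw [ContinuousLinearMap.fderiv]
    simp
  have hsq : ContDiff ℝ ∞ fun x => ψ x ^ 2 := h.smooth.pow 2
  have hs : HasCompactSupport fun x => ψ x ^ 2 := h.compact.comp_left (g := (· ^ 2)) (by simp)
  have hpsq : ∀ x, pd i (fun x => ψ x ^ 2) x = 2 * ψ x * pd i ψ x := fun x => by
    have := ((h.smooth.differentiable (by simp) x).hasFDerivAt.pow 2).fderiv
    simp only [Plate.pd, this]
    simp
  have hparts := integral_mul_pd hx hsq hs i
  simp only [hpx, hpsq, one_mul] at hparts
  have i1 := h.integrable_sq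
  have i2 := (h.pd i).integrable_sq
  have i3 : Integrable fun x : Euc d => x i * (2 * ψ x * pd i ψ x) :=
    (hx.continuous.mul ((continuous_const.mul h.smooth.continuous).mul
      (h.pd i).smooth.continuous)).integrable_of_hasCompactSupport (h.pd i).compact.mul_left.mul_left
  have hle : ∫ x : Euc d, -(x i * (2 * ψ x * pd i ψ x)) ≤
      ∫ x, ((1 / 2 : ℝ) * ψ x ^ 2 + 2 * R ^ 2 * pd i ψ x ^ 2) := by
    refine integral_mono i3.neg ((i1.const_mul _).add (i2.const_mul _)) fun x => ?_
    by_cases hxG : x ∈ G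
    · exact neg_mul_le_young (hR x hxG)
    · simp [h.eq_zero hxG, (h.pd i).eq_zero hxG]
  rw [integral_neg, hparts, neg_neg, integral_add (i1.const_mul _) (i2.const_mul _),
    integral_const_mul, integral_const_mul] at hle
  linarith

lemma integral_sq_le_integral_pd_pd_sq {G : Set (Euc d)} {R : ℝ} (i : Fin d)
    (hR : ∀ x ∈ G, |x i| ≤ R) {ψ : Euc d → ℝ} (h : IsTest G ψ) :
    ∫ x, ψ x ^ 2 ≤ ((2 * R) ^ 2) ^ 2 * ∫ x, pd i (pd i ψ) x ^ 2 := by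
  have h1 := integral_sq_le_integral_pd_sq i hR h
  have h2 := mul_le_mul_of_nonneg_left (integral_sq_le_integral_pd_sq i hR (h.pd i))
    (sq_nonneg (2 * R))
  linarith

lemma SymTensor.sq_comp_le (i j : Fin d) (κ : SymTensor d) :
    SymTensor.comp i j κ ^ 2 ≤ ‖κ‖ ^ 2 := by
  have h : ‖κ.1 (i, j)‖ ≤ ‖κ.1‖ := PiLp.norm_apply_le κ.1 (i, j)
  exact sq_le_sq.2 (by rw [abs_norm]; exact h)

/-! ### Conforming and broken spaces -/

lemma memLp_test {φ : Euc d → ℝ} (h : IsTest Ω φ) :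
    MemLp φ 2 (volume.restrict Ω) ∧ MemLp (symHess φ) 2 (volume.restrict Ω) :=
  ⟨h.smooth.continuous.memLp_of_hasCompactSupport h.compact,
    (symHess_continuous h.smooth).memLp_of_hasCompactSupport (symHess_compact h.compact)⟩

/-- The pair `(φ, ε∇φ)` of a test function `φ ∈ 𝒟(Ω)`. -/
def testPair {φ : Euc d → ℝ} (h : IsTest Ω φ) : WithLp 2 (L2 Ω × L2s Ω) :=
  WithLp.toLp 2 ((memLp_test h).1.toLp φ, (memLp_test h).2.toLp (symHess φ))

lemma testPair_fst {φ : Euc d → ℝ} (h : IsTest Ω φ) :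
    ((testPair h).fst : Euc d → ℝ) =ᵐ[volume.restrict Ω] φ := (memLp_test h).1.coeFn_toLp

lemma testPair_snd {φ : Euc d → ℝ} (h : IsTest Ω φ) :
    ((testPair h).snd : Euc d → SymTensor d) =ᵐ[volume.restrict Ω] symHess φ :=
  (memLp_test h).2.coeFn_toLp

lemma setOf_test_eq : {p : WithLp 2 (L2 Ω × L2s Ω) | ∃ φ : Euc d → ℝ, IsTest Ω φ ∧
    (p.fst : Euc d → ℝ) =ᵐ[volume.restrict Ω] φ ∧
    (p.snd : Euc d → SymTensor d) =ᵐ[volume.restrict Ω] symHess φ} =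
    {p | ∃ (φ : Euc d → ℝ) (h : IsTest Ω φ), p = testPair h} := by
  ext p
  constructor
  · rintro ⟨φ, h, h1, h2⟩
    refine ⟨φ, h, (WithLp.ofLp_injective 2) (Prod.ext (Lp.ext ?_) (Lp.ext ?_))⟩
    · exact h1.trans (testPair_fst h).symm
    · exact h2.trans (testPair_snd h).symm
  · rintro ⟨φ, h, rfl⟩
    exact ⟨φ, h, testPair_fst h, testPair_snd h⟩

lemma testPair_mem {φ : Euc d → ℝ} (h : IsTest Ω φ) : testPair h ∈ h20Sub Ω :=
  Submodule.le_topologicalClosure _ (Submodule.subset_span ⟨φ, h, testPair_fst h, testPair_snd h⟩)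

lemma pd_add (i : Fin d) {φ ψ : Euc d → ℝ} (hφ : ContDiff ℝ ∞ φ) (hψ : ContDiff ℝ ∞ ψ) :
    pd i (φ + ψ) = pd i φ + pd i ψ := by
  funext x
  simp only [pd, Pi.add_apply]
  rw [fderiv_add (hφ.differentiable (by simp) x) (hψ.differentiable (by simp) x)]
  rfl

lemma pd_const_smul (i : Fin d) (c : ℝ) {φ : Euc d → ℝ} (hφ : ContDiff ℝ ∞ φ) :
    pd i (c • φ) = c • pd i φ := by
  funext x
  simp only [pd, Pi.smul_apply]
  rw [fderiv_const_smul (hφ.differentiable (by simp) x)]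
  rfl

/-- The pairs `(φ, ε∇φ)` already form a subspace, so an inequality that is not linear in `φ` may be
checked on them alone. -/
lemma exists_eq_testPair_of_mem_span {p : WithLp 2 (L2 Ω × L2s Ω)}
    (hp : p ∈ Submodule.span ℝ {p : WithLp 2 (L2 Ω × L2s Ω) |
      ∃ (φ : Euc d → ℝ) (h : IsTest Ω φ), p = testPair h}) :
    ∃ (φ : Euc d → ℝ) (h : IsTest Ω φ), p = testPair h := by
  rw [← setOf_test_eq] at hp
  change p ∈ {p | ∃ (φ : Euc d → ℝ) (h : IsTest Ω φ), p = testPair h}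
  rw [← setOf_test_eq]
  induction hp using Submodule.span_induction with
  | mem p hp => exact hp
  | zero =>
    have h0 : IsTest Ω (0 : Euc d → ℝ) :=
      ⟨contDiff_const, HasCompactSupport.zero, by simp⟩
    refine ⟨0, h0, Lp.coeFn_zero _ _ _, (Lp.coeFn_zero _ _ _).trans (.of_forall fun x => ?_)⟩
    have hz : ∀ i, pd i (0 : Euc d → ℝ) = 0 := fun i => by
      simpa using pd_const_smul i 0 h0.smooth
    refine Subtype.ext (PiLp.ext fun q => ?_)
    change (0 : ℝ) = (1 / 2 : ℝ) * (pd q.1 (pd q.2 0) x + pd q.2 (pd q.1 0) x)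
    simp [hz]
  | add p q _ _ hp hq =>
    obtain ⟨φ, hφ, h1, h2⟩ := hp
    obtain ⟨ψ, hψ, h3, h4⟩ := hq
    refine ⟨φ + ψ, ⟨hφ.smooth.add hψ.smooth, hφ.compact.add hψ.compact,
      (tsupport_add φ ψ).trans (union_subset hφ.support hψ.support)⟩, ?_, ?_⟩
    · exact (Lp.coeFn_add p.fst q.fst).trans (h1.add h3)
    · refine ((Lp.coeFn_add p.snd q.snd).trans (h2.add h4)).trans (.of_forall fun x => ?_)
      refine Subtype.ext (PiLp.ext fun r => ?_)
      change (1 / 2 : ℝ) * (pd r.1 (pd r.2 φ) x + pd r.2 (pd r.1 φ) x) +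
        (1 / 2 : ℝ) * (pd r.1 (pd r.2 ψ) x + pd r.2 (pd r.1 ψ) x) =
        (1 / 2 : ℝ) * (pd r.1 (pd r.2 (φ + ψ)) x + pd r.2 (pd r.1 (φ + ψ)) x)
      simp only [pd_add _ hφ.smooth hψ.smooth,
        pd_add _ (pd_smooth _ hφ.smooth) (pd_smooth _ hψ.smooth), Pi.add_apply]
      ring
  | smul c p _ hp =>
    obtain ⟨φ, hφ, h1, h2⟩ := hp
    refine ⟨c • φ, ⟨hφ.smooth.const_smul c, hφ.compact.smul_left (f := fun _ => c),
      (tsupport_smul_subset_right (fun _ => c) φ).trans hφ.support⟩, ?_, ?_⟩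
    · exact (Lp.coeFn_smul c p.fst).trans (h1.const_smul c)
    · refine ((Lp.coeFn_smul c p.snd).trans (h2.const_smul c)).trans (.of_forall fun x => ?_)
      refine Subtype.ext (PiLp.ext fun r => ?_)
      change c * ((1 / 2 : ℝ) * (pd r.1 (pd r.2 φ) x + pd r.2 (pd r.1 φ) x)) =
        (1 / 2 : ℝ) * (pd r.1 (pd r.2 (c • φ)) x + pd r.2 (pd r.1 (c • φ)) x)
      simp only [pd_const_smul _ _ hφ.smooth, pd_const_smul _ _ (pd_smooth _ hφ.smooth),
        Pi.smul_apply, smul_eq_mul]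
      ring

/-- A closed condition on pairs holds on `H²₀(Ω)` as soon as it holds for test functions. -/
lemma h20Sub_induction {P : WithLp 2 (L2 Ω × L2s Ω) → Prop} (hP : IsClosed {p | P p})
    (h : ∀ (φ : Euc d → ℝ) (hφ : IsTest Ω φ), P (testPair hφ))
    {p : WithLp 2 (L2 Ω × L2s Ω)} (hp : p ∈ h20Sub Ω) : P p := by
  rw [h20Sub, setOf_test_eq] at hp
  refine closure_minimal (fun q hq => ?_) hP hp
  obtain ⟨φ, hφ, rfl⟩ := exists_eq_testPair_of_mem_span hq
  exact h φ hφ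

lemma inner_testPair_fst (g : L2 Ω) {φ : Euc d → ℝ} (h : IsTest Ω φ) :
    ⟪g, (testPair h).fst⟫_ℝ = ∫ x in Ω, g x * φ x := by
  rw [L2.inner_def]
  refine integral_congr_ae ?_
  filter_upwards [testPair_fst h] with x hx
  rw [hx]
  simp [mul_comm]

lemma inner_testPair_snd (Θ : L2s Ω) {φ : Euc d → ℝ} (h : IsTest Ω φ) :
    ⟪Θ, (testPair h).snd⟫_ℝ = ∫ x in Ω, ⟪Θ x, symHess φ x⟫_ℝ := by
  rw [L2.inner_def]
  refine integral_congr_ae ?_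
  filter_upwards [testPair_snd h] with x hx
  rw [hx]

/-- `H(div div, Ω)` and `H²₀(Ω)` are dual to each other: `(Θ, ε∇z) = (div div Θ, z)`. -/
lemma inner_hess_eq_inner_divdiv {q : WithLp 2 (L2s Ω × L2 Ω)} (hq : q ∈ weakDivDivOn Ω Ω)
    {p : WithLp 2 (L2 Ω × L2s Ω)} (hp : p ∈ h20Sub Ω) :
    ⟪q.fst, p.snd⟫_ℝ = ⟪q.snd, p.fst⟫_ℝ := by
  refine h20Sub_induction (P := fun p => ⟪q.fst, p.snd⟫_ℝ = ⟪q.snd, p.fst⟫_ℝ) ?_ ?_ hp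
  · exact isClosed_eq (continuous_const.inner (WithLp.sndL 2 ℝ _ _).continuous)
      (continuous_const.inner (WithLp.fstL 2 ℝ _ _).continuous)
  · intro φ hφ
    rw [inner_testPair_fst, inner_testPair_snd]
    exact hq φ hφ

/-- Testing against `H²₀(Ω)` characterizes `H(div div, Ω)`: conversely to
`inner_hess_eq_inner_divdiv`, the identity implies the weak `div div` condition. -/
lemma mem_weakDivDivOn_of_inner {q : WithLp 2 (L2s Ω × L2 Ω)}
    (h : ∀ p ∈ h20Sub Ω, ⟪q.fst, p.snd⟫_ℝ = ⟪q.snd, p.fst⟫_ℝ) : q ∈ weakDivDivOn Ω Ω := by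
  intro φ hφ
  rw [← inner_testPair_fst _ hφ, ← inner_testPair_snd _ hφ]
  exact h _ (testPair_mem hφ)

lemma norm_sq_testPair_fst {φ : Euc d → ℝ} (hφ : IsTest Ω φ) :
    ‖(testPair hφ).fst‖ ^ 2 = ∫ x, φ x ^ 2 := by
  rw [← real_inner_self_eq_norm_sq, inner_testPair_fst]
  refine Eq.trans (integral_congr_ae (g := fun x => φ x ^ 2) ?_)
    (setIntegral_eq_integral_of_forall_compl_eq_zero fun x hx => by simp [hφ.eq_zero hx])
  filter_upwards [testPair_fst hφ] with x hx
  rw [hx, sq]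

lemma norm_sq_testPair_snd {φ : Euc d → ℝ} (hφ : IsTest Ω φ) :
    ‖(testPair hφ).snd‖ ^ 2 = ∫ x in Ω, ‖symHess φ x‖ ^ 2 := by
  rw [← real_inner_self_eq_norm_sq, inner_testPair_snd]
  refine integral_congr_ae ?_
  filter_upwards [testPair_snd hφ] with x hx
  rw [hx, real_inner_self_eq_norm_sq]

lemma integral_pd_pd_sq_le {φ : Euc d → ℝ} (hφ : IsTest Ω φ) (i : Fin d) :
    ∫ x, pd i (pd i φ) x ^ 2 ≤ ‖(testPair hφ).snd‖ ^ 2 := by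
  have h2 := (hφ.pd i).pd i
  have hs : ∀ x, SymTensor.comp i i (symHess φ x) = pd i (pd i φ) x := fun x => by
    rw [comp_symHess]; ring
  have i1 := h2.integrable_sq
  have hc : Continuous fun x => ‖symHess φ x‖ ^ 2 := (symHess_continuous hφ.smooth).norm.pow 2
  have hsc : HasCompactSupport fun x => ‖symHess φ x‖ ^ 2 :=
    (symHess_compact hφ.compact).comp_left (g := fun κ => ‖κ‖ ^ 2) (by simp)
  have i2 := hc.integrable_of_hasCompactSupport (μ := volume) hsc
  rw [norm_sq_testPair_snd]
  refine Eq.trans_le (setIntegral_eq_integral_of_forall_compl_eq_zero (s := Ω)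
    fun x hx => by simp [h2.eq_zero hx]).symm ?_
  refine integral_mono i1.integrableOn i2.integrableOn fun x => ?_
  simpa only [hs] using SymTensor.sq_comp_le i i (symHess φ x)

/-- The Poincaré inequality on `H²₀(Ω)`. -/
lemma exists_poincare (hd : 0 < d) (hΩ : Bornology.IsBounded Ω) :
    ∃ c : ℝ, 0 ≤ c ∧ ∀ p ∈ h20Sub Ω, ‖p.fst‖ ^ 2 ≤ c * ‖p.snd‖ ^ 2 := by
  obtain ⟨R, hR⟩ := hΩ.exists_norm_le
  let i : Fin d := ⟨0, hd⟩
  have hRi : ∀ x ∈ Ω, |x i| ≤ R := fun x hx => (PiLp.norm_apply_le x i).trans (hR x hx)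
  have c1 : Continuous fun p : WithLp 2 (L2 Ω × L2s Ω) => ‖p.fst‖ ^ 2 :=
    (WithLp.fstL 2 ℝ (L2 Ω) (L2s Ω)).continuous.norm.pow 2
  have c2 : Continuous fun p : WithLp 2 (L2 Ω × L2s Ω) => ((2 * R) ^ 2) ^ 2 * ‖p.snd‖ ^ 2 :=
    continuous_const.mul ((WithLp.sndL 2 ℝ (L2 Ω) (L2s Ω)).continuous.norm.pow 2)
  refine ⟨((2 * R) ^ 2) ^ 2, by positivity, fun p hp => ?_⟩
  refine h20Sub_induction (isClosed_le c1 c2) (fun φ hφ => ?_) hp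
  rw [norm_sq_testPair_fst]
  exact (integral_sq_le_integral_pd_pd_sq i hRi hφ).trans
    (mul_le_mul_of_nonneg_left (integral_pd_pd_sq_le hφ i) (by positivity))

/-- `H²₀(Ω) ⊆ H²(𝒯)`: the symmetrized Hessian of a test function is also its weak one. -/
lemma h20Sub_le_h2BrSub (𝒯 : Mesh Ω) : h20Sub Ω ≤ h2BrSub 𝒯 := by
  simp only [h2BrSub, le_iInf_iff]
  intro T hT p hp
  refine h20Sub_induction (P := fun p => p ∈ weakHessOn Ω T) (weakHessOn_isClosed Ω T) ?_ hp
  intro ψ hψ φ hφ i j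
  have hφΩ := hφ.mono (𝒯.subset T hT)
  have e1 : ∫ x in Ω, (testPair hψ).fst x * SymTensor.comp i j (symHess φ x) =
      ∫ x, ψ x * SymTensor.comp i j (symHess φ x) := by
    refine Eq.trans (integral_congr_ae
      (g := fun x => ψ x * SymTensor.comp i j (symHess φ x)) ?_)
      (setIntegral_eq_integral_of_forall_compl_eq_zero fun x hx => by simp [hψ.eq_zero hx])
    filter_upwards [testPair_fst hψ] with x hx
    rw [hx]
  have e2 : ∫ x in Ω, SymTensor.comp i j ((testPair hψ).snd x) * φ x =
      ∫ x, SymTensor.comp i j (symHess ψ x) * φ x := by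
    refine Eq.trans (integral_congr_ae
      (g := fun x => SymTensor.comp i j (symHess ψ x) * φ x) ?_)
      (setIntegral_eq_integral_of_forall_compl_eq_zero fun x hx => by simp [hφΩ.eq_zero hx])
    filter_upwards [testPair_snd hψ] with x hx
    rw [hx]
  rw [e1, e2]
  exact integral_mul_comp_symHess hψ.smooth hφ.smooth hφ.compact i j

lemma weakDivDivOn_le_hddBrSub (𝒯 : Mesh Ω) : weakDivDivOn Ω Ω ≤ hddBrSub 𝒯 := by
  simp only [hddBrSub, le_iInf_iff]
  intro T hT p hp φ hφ
  exact hp φ (hφ.mono (𝒯.subset T hT))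

lemma prod_norm_le_add {X Y : Type*} [SeminormedAddCommGroup X] [SeminormedAddCommGroup Y]
    (p : WithLp 2 (X × Y)) : ‖p‖ ≤ ‖p.fst‖ + ‖p.snd‖ := by
  refine le_of_sq_le_sq ?_ (by positivity)
  rw [WithLp.prod_norm_sq_eq_of_L2]
  linarith [mul_nonneg (norm_nonneg p.fst) (norm_nonneg p.snd),
    show (‖p.fst‖ + ‖p.snd‖) ^ 2 = ‖p.fst‖ ^ 2 + ‖p.snd‖ ^ 2 + 2 * (‖p.fst‖ * ‖p.snd‖) by ring]

/-- A mesh covers `Ω` up to a null set, so the element-wise inner products add up to that of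
`L₂(Ω)`. -/
lemma sum_elementInner {F : Type*} [NormedAddCommGroup F] [InnerProductSpace ℝ F]
    (𝒯 : Mesh Ω) (u v : Lp F 2 (volume.restrict Ω)) :
    ∑ T ∈ 𝒯.elements, elementInner T u v = ⟪u, v⟫_ℝ := by
  have hI : Integrable (fun x => ⟪u x, v x⟫_ℝ) (volume.restrict Ω) := L2.integrable_inner u v
  have hU : MeasurableSet (⋃ T ∈ 𝒯.elements, T) :=
    (isOpen_biUnion fun T hT => (𝒯.lipschitz T hT).isOpen).measurableSet
  have hae : (⋃ T ∈ 𝒯.elements, T) =ᵐ[volume.restrict Ω] (univ : Set (Euc d)) := by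
    rw [ae_eq_univ, Measure.restrict_apply hU.compl, inter_comm]
    exact 𝒯.cover
  simp only [elementInner]
  rw [← integral_biUnion_finset 𝒯.elements (s := fun T => T)
    (fun T hT => (𝒯.lipschitz T hT).isOpen.measurableSet)
    (fun T hT T' hT' h => 𝒯.disjoint T hT T' hT' h) (fun T _ => hI.integrableOn),
    setIntegral_congr_set hae, setIntegral_univ, L2.inner_def]

/-! ### The material law on `𝕃₂ˢ(Ω)` -/

lemma SymTensor.inner_one (κ : SymTensor d) : ⟪SymTensor.one d, κ⟫_ℝ = SymTensor.tr d κ := by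
  change ⟪(SymTensor.one d).1, κ.1⟫_ℝ = SymTensor.tr d κ
  have h : SymTensor.tr d κ = ∑ i, κ.1 (i, i) := by
    simp only [SymTensor.tr, sum_apply]
    rfl
  rw [h, PiLp.inner_apply, Fintype.sum_prod_type]
  simp [SymTensor.one]

lemma inner_matC_left (E t ν : ℝ) (κ η : SymTensor d) :
    ⟪matC d E t ν κ, η⟫_ℝ = ⟪κ, matC d E t ν η⟫_ℝ := by
  simp only [matC, smul_apply, add_apply,
    ContinuousLinearMap.smulRight_apply, ContinuousLinearMap.id_apply, real_inner_smul_left,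
    real_inner_smul_right, inner_add_left, inner_add_right, SymTensor.inner_one,
    real_inner_comm (SymTensor.one d) κ]
  ring

/-- The material tensor acting pointwise on `𝕃₂ˢ(Ω)`. -/
def matCLp (Ω : Set (Euc d)) (E t ν : ℝ) : L2s Ω →L[ℝ] L2s Ω :=
  (matC d E t ν).compLpL 2 (volume.restrict Ω)

lemma inner_matCLp_left (E t ν : ℝ) (κ η : L2s Ω) :
    ⟪matCLp Ω E t ν κ, η⟫_ℝ = ⟪κ, matCLp Ω E t ν η⟫_ℝ := by
  simp only [L2.inner_def]
  refine integral_congr_ae ?_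
  filter_upwards [(matC d E t ν).coeFn_compLpL (p := 2) (μ := volume.restrict Ω) κ,
    (matC d E t ν).coeFn_compLpL (p := 2) (μ := volume.restrict Ω) η] with x h1 h2
  rw [matCLp, h1, h2, inner_matC_left]

/-- `ContinuousLinearMap.inverse` is the true inverse of `𝒞` rather than its default value `0`,
because `𝒞` is injective on a finite-dimensional space. -/
lemma matC_equiv {E t ν : ℝ}
    (hC : ∀ κ : SymTensor d, κ ≠ 0 → 0 < ⟪matC d E t ν κ, κ⟫_ℝ) :
    ∃ e : SymTensor d ≃L[ℝ] SymTensor d,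
    (e : SymTensor d →L[ℝ] SymTensor d) = matC d E t ν := by
  have hinj : Function.Injective (matC d E t ν : SymTensor d →ₗ[ℝ] SymTensor d) := by
    refine (injective_iff_map_eq_zero _).2 fun κ hκ => ?_
    by_contra h
    have h1 := hC κ h
    rw [show matC d E t ν κ = 0 from hκ, inner_zero_left] at h1
    exact lt_irrefl _ h1
  refine ⟨(LinearEquiv.ofInjectiveEndo _ hinj).toContinuousLinearEquiv, ?_⟩
  ext1 κ
  rfl

lemma matCInv_matCLp {E t ν : ℝ}
    (hC : ∀ κ : SymTensor d, κ ≠ 0 → 0 < ⟪matC d E t ν κ, κ⟫_ℝ)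
    (κ : L2s Ω) : matCInv E t ν (matCLp Ω E t ν κ) = κ := by
  obtain ⟨e, he⟩ := matC_equiv hC
  refine Lp.ext ?_
  filter_upwards [(matC d E t ν).coeFn_compLpL (p := 2) (μ := volume.restrict Ω) κ,
    (matC d E t ν).inverse.coeFn_compLpL (p := 2) (μ := volume.restrict Ω)
      (matCLp Ω E t ν κ)] with x h1 h2
  rw [matCInv, h2, matCLp, h1, ← he, ContinuousLinearMap.inverse_equiv]
  exact e.symm_apply_apply _

lemma matCLp_matCInv {E t ν : ℝ}
    (hC : ∀ κ : SymTensor d, κ ≠ 0 → 0 < ⟪matC d E t ν κ, κ⟫_ℝ)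
    (κ : L2s Ω) : matCLp Ω E t ν (matCInv E t ν κ) = κ := by
  obtain ⟨e, he⟩ := matC_equiv hC
  refine Lp.ext ?_
  filter_upwards [(matC d E t ν).inverse.coeFn_compLpL (p := 2) (μ := volume.restrict Ω) κ,
    (matC d E t ν).coeFn_compLpL (p := 2) (μ := volume.restrict Ω)
      (matCInv E t ν κ)] with x h1 h2
  rw [matCLp, h2, matCInv, h1, ← he, ContinuousLinearMap.inverse_equiv]
  exact e.apply_symm_apply _

lemma matC_coercive {E t ν : ℝ}
    (hC : ∀ κ : SymTensor d, κ ≠ 0 → 0 < ⟪matC d E t ν κ, κ⟫_ℝ) :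
    ∃ α : ℝ, 0 < α ∧ ∀ κ : SymTensor d,
    α * ‖κ‖ ^ 2 ≤ ⟪matC d E t ν κ, κ⟫_ℝ := by
  have : ProperSpace (SymTensor d) := FiniteDimensional.proper ℝ _
  obtain ⟨α, hα, h⟩ := (isCompact_sphere (0 : SymTensor d) 1).exists_forall_le'
    (f := fun κ => ⟪matC d E t ν κ, κ⟫_ℝ) (a := 0)
    ((matC d E t ν).continuous.inner continuous_id).continuousOn
    (fun κ hκ => hC κ (ne_zero_of_mem_unit_sphere ⟨κ, hκ⟩))
  refine ⟨α, hα, fun κ => ?_⟩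
  rcases eq_or_ne κ 0 with rfl | hκ
  · simp
  · have hn : ‖κ‖ ≠ 0 := norm_ne_zero_iff.2 hκ
    have h1 := h (‖κ‖⁻¹ • κ) (by simp [norm_smul, hn])
    simp only [map_smul, real_inner_smul_left, real_inner_smul_right] at h1
    have h2 := mul_le_mul_of_nonneg_left h1 (sq_nonneg ‖κ‖)
    calc α * ‖κ‖ ^ 2 = ‖κ‖ ^ 2 * α := mul_comm _ _
      _ ≤ _ := h2
      _ = _ := by field_simp

lemma matCLp_coercive {E t ν : ℝ}
    (hC : ∀ κ : SymTensor d, κ ≠ 0 → 0 < ⟪matC d E t ν κ, κ⟫_ℝ)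
    (Ω : Set (Euc d)) : ∃ α : ℝ, 0 < α ∧ ∀ κ : L2s Ω,
    α * ‖κ‖ ^ 2 ≤ ⟪matCLp Ω E t ν κ, κ⟫_ℝ := by
  obtain ⟨α, hα, h⟩ := matC_coercive hC
  refine ⟨α, hα, fun κ => ?_⟩
  rw [← real_inner_self_eq_norm_sq, ← real_inner_smul_left]
  simp only [L2.inner_def]
  refine integral_mono_ae (L2.integrable_inner _ _) (L2.integrable_inner _ _) ?_
  filter_upwards [(matC d E t ν).coeFn_compLpL (p := 2) (μ := volume.restrict Ω) κ,
    Lp.coeFn_smul α κ] with x h1 h2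
  rw [matCLp, h1, h2, Pi.smul_apply, real_inner_smul_left, real_inner_self_eq_norm_sq]
  exact h _

/-! ### The clamped plate problem on `H²₀(Ω)` -/

instance : CompleteSpace (H20 Ω) :=
  (Submodule.isClosed_topologicalClosure _).completeSpace_coe

/-- The weak plate problem `(𝒞 ε∇z, ε∇φ) = F(φ)` is well posed in `H²₀(Ω)`, by the Lax–Milgram
lemma: `𝒞` is coercive and the Poincaré inequality controls `‖z‖` by `‖ε∇z‖`. -/
lemma exists_plate_solution {E t ν : ℝ}
    (hC : ∀ κ : SymTensor d, κ ≠ 0 → 0 < ⟪matC d E t ν κ, κ⟫_ℝ)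
    (hd : 0 < d) (hΩ : Bornology.IsBounded Ω) :
    ∃ K : ℝ, 0 ≤ K ∧ ∀ F : StrongDual ℝ (H20 Ω), ∃ z : H20 Ω,
      (∀ φ : H20 Ω, ⟪matCLp Ω E t ν z.hess, φ.hess⟫_ℝ = F φ) ∧ ‖z‖ ≤ K * ‖F‖ := by
  obtain ⟨c, hc, hP⟩ := exists_poincare hd hΩ
  obtain ⟨α, hα, hcoer⟩ := matCLp_coercive hC Ω
  let B : H20 Ω →L[ℝ] H20 Ω →L[ℝ] ℝ :=
    (innerSL ℝ).bilinearComp ((matCLp Ω E t ν).comp H20.hess) H20.hess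
  have hB : ∀ z φ, B z φ = ⟪matCLp Ω E t ν z.hess, φ.hess⟫_ℝ := fun z φ => rfl
  have hβ : 0 < α / (1 + c) := by positivity
  have hBc : ∀ z, α / (1 + c) * ‖z‖ * ‖z‖ ≤ B z z := fun z => by
    have h1 : ‖z‖ ^ 2 = ‖z.fn‖ ^ 2 + ‖z.hess‖ ^ 2 := WithLp.prod_norm_sq_eq_of_L2 z.1
    have h2 : ‖z.fn‖ ^ 2 ≤ c * ‖z.hess‖ ^ 2 := hP z.1 z.2
    have h3 := mul_le_mul_of_nonneg_left (h1.le.trans (add_le_add_left h2 _)) hβ.le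
    calc α / (1 + c) * ‖z‖ * ‖z‖ = α / (1 + c) * ‖z‖ ^ 2 := by ring
      _ ≤ _ := h3
      _ = α * ‖z.hess‖ ^ 2 := by field_simp; ring
      _ ≤ _ := hcoer _
  have hco : IsCoercive B := ⟨α / (1 + c), hβ, hBc⟩
  refine ⟨(α / (1 + c))⁻¹, by positivity, fun F => ?_⟩
  let z := hco.continuousLinearEquivOfBilin.symm ((InnerProductSpace.toDual ℝ (H20 Ω)).symm F)
  have hz : ∀ φ, B z φ = F φ := fun φ => by
    rw [← hco.continuousLinearEquivOfBilin_apply, ContinuousLinearEquiv.apply_symm_apply,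
      InnerProductSpace.toDual_symm_apply]
  refine ⟨z, hz, ?_⟩
  rw [le_inv_mul_iff₀ hβ]
  rcases (norm_nonneg z).eq_or_lt' with h0 | h0
  · simp [h0]
  · refine le_of_mul_le_mul_right ?_ h0
    exact (hBc z).trans ((hz z).le.trans ((le_abs_self _).trans (F.le_opNorm z)))

/-- The unbroken adjoint problem: for `p = (u, M)` there are `z ∈ H²₀(Ω)` and `Θ ∈ H(div div, Ω)`
with `ε∇z + 𝒞⁻¹Θ = M` and `div div Θ = u`, bounded by `(u, M)`. -/
lemma exists_adjoint_solution {E t ν : ℝ}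
    (hC : ∀ κ : SymTensor d, κ ≠ 0 → 0 < ⟪matC d E t ν κ, κ⟫_ℝ)
    (hd : 0 < d) (hΩ : Bornology.IsBounded Ω) :
    ∃ K : ℝ, 0 ≤ K ∧ ∀ p : WithLp 2 (L2 Ω × L2s Ω), ∃ (z : H20 Ω) (Θ : HDD Ω),
      z.hess + matCInv E t ν Θ.fn = p.snd ∧ Θ.divdiv = p.fst ∧ ‖z‖ + ‖Θ‖ ≤ K * ‖p‖ := by
  obtain ⟨K, hK, hsolve⟩ := exists_plate_solution hC hd hΩ
  set c : ℝ := ‖matCLp Ω E t ν‖ with hc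
  have hc0 : 0 ≤ c := norm_nonneg (matCLp Ω E t ν)
  refine ⟨K * (c + 1) + (c * (1 + K * (c + 1)) + 1), by positivity, fun p => ?_⟩
  have hp1 : ‖p.fst‖ ≤ ‖p‖ := WithLp.norm_fst_le _ p
  have hp2 : ‖p.snd‖ ≤ ‖p‖ := WithLp.norm_snd_le _ p
  have hfn : ∀ z : H20 Ω, ‖z.fn‖ ≤ ‖z‖ := fun z => WithLp.norm_fst_le _ z.1
  have hhess : ∀ z : H20 Ω, ‖z.hess‖ ≤ ‖z‖ := fun z => WithLp.norm_snd_le _ z.1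
  -- Eliminating `Θ = 𝒞(M - ε∇z)` leaves `(𝒞 ε∇z, ε∇φ) = (𝒞M, ε∇φ) - (u, φ)` for `z`.
  let F : StrongDual ℝ (H20 Ω) :=
    (innerSL ℝ (matCLp Ω E t ν p.snd)).comp H20.hess - (innerSL ℝ p.fst).comp H20.fn
  have hF : ∀ φ : H20 Ω, F φ = ⟪matCLp Ω E t ν p.snd, φ.hess⟫_ℝ - ⟪p.fst, φ.fn⟫_ℝ := fun φ => rfl
  have hcM : ∀ κ, ‖matCLp Ω E t ν κ‖ ≤ c * ‖κ‖ := fun κ => (matCLp Ω E t ν).le_opNorm κ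
  have hFn : ‖F‖ ≤ (c + 1) * ‖p‖ := by
    refine F.opNorm_le_bound (by positivity) fun φ => ?_
    rw [hF]
    refine (norm_sub_le _ _).trans ?_
    calc _ ≤ ‖matCLp Ω E t ν p.snd‖ * ‖φ.hess‖ + ‖p.fst‖ * ‖φ.fn‖ :=
          add_le_add (norm_inner_le_norm _ _) (norm_inner_le_norm _ _)
      _ ≤ (c * ‖p‖) * ‖φ‖ + ‖p‖ * ‖φ‖ := by
          gcongr
          · exact (hcM _).trans (by gcongr)
          · exact hhess φ
          · exact hfn φ
      _ = _ := by ring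
  obtain ⟨z, hz, hzn⟩ := hsolve F
  have hzp : ‖z‖ ≤ K * (c + 1) * ‖p‖ := hzn.trans (by rw [mul_assoc]; gcongr)
  let q : WithLp 2 (L2s Ω × L2 Ω) := WithLp.toLp 2 (matCLp Ω E t ν (p.snd - z.hess), p.fst)
  have hq : q ∈ weakDivDivOn Ω Ω := by
    refine mem_weakDivDivOn_of_inner fun φ hφ => ?_
    have h1 := (hz ⟨φ, hφ⟩).trans (hF ⟨φ, hφ⟩)
    change ⟪matCLp Ω E t ν (p.snd - z.hess), φ.snd⟫_ℝ = ⟪p.fst, φ.fst⟫_ℝ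
    change ⟪matCLp Ω E t ν z.hess, φ.snd⟫_ℝ =
      ⟪matCLp Ω E t ν p.snd, φ.snd⟫_ℝ - ⟪p.fst, φ.fst⟫_ℝ at h1
    rw [map_sub, inner_sub_left, h1]
    ring
  refine ⟨z, ⟨q, hq⟩, ?_, rfl, ?_⟩
  · change z.hess + matCInv E t ν (matCLp Ω E t ν (p.snd - z.hess)) = p.snd
    rw [matCInv_matCLp hC]
    abel
  · have h1 : ‖q.fst‖ ≤ c * ((1 + K * (c + 1)) * ‖p‖) := by
      refine (hcM _).trans ?_
      gcongr
      refine (norm_sub_le _ _).trans ?_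
      rw [add_mul, one_mul]
      exact add_le_add hp2 ((hhess z).trans hzp)
    have h2 : ‖q‖ ≤ ‖q.fst‖ + ‖q.snd‖ := prod_norm_le_add q
    have h3 : ‖q.snd‖ ≤ ‖p‖ := hp1
    change ‖z‖ + ‖q‖ ≤ _
    linarith

/-! ### Traces -/

/-- The inclusion `H²₀(Ω) ⊆ H²(𝒯)`; it keeps the pair `(z, ε∇z)`, hence the norm. -/
def H20.toBroken (𝒯 : Mesh Ω) (z : H20 Ω) : H2Br 𝒯 := ⟨z.1, h20Sub_le_h2BrSub 𝒯 z.2⟩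

/-- The inclusion `H(div div, Ω) ⊆ H(div div, 𝒯)`; it keeps the pair `(Θ, div div Θ)`, hence the
norm. -/
def HDD.toBroken (𝒯 : Mesh Ω) (Θ : HDD Ω) : HDDBr 𝒯 := ⟨Θ.1, weakDivDivOn_le_hddBrSub 𝒯 Θ.2⟩

lemma trDD_apply (𝒯 : Mesh Ω) (Θ : HDD Ω) (z : H2Br 𝒯) :
    trDD 𝒯 Θ z = ⟪Θ.divdiv, z.fn⟫_ℝ - ⟪Θ.fn, z.hess⟫_ℝ := by
  rw [← sum_elementInner 𝒯, ← sum_elementInner 𝒯, ← Finset.sum_sub_distrib]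
  rfl

lemma trGG_apply (𝒯 : Mesh Ω) (z : H20 Ω) (Θ : HDDBr 𝒯) :
    trGG 𝒯 z Θ = ⟪Θ.divdiv, z.fn⟫_ℝ - ⟪Θ.fn, z.hess⟫_ℝ := by
  rw [← sum_elementInner 𝒯, ← sum_elementInner 𝒯, ← Finset.sum_sub_distrib]
  rfl

/-- Conforming test functions do not see the skeleton unknown `q̂`. -/
lemma TraceDD.pairing_toBroken {𝒯 : Mesh Ω} (q : TraceDD 𝒯) (z : H20 Ω) :
    q.pairing (z.toBroken 𝒯) = 0 := by
  obtain ⟨_, Θ, rfl⟩ := q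
  change trDD 𝒯 Θ (z.toBroken 𝒯) = 0
  rw [trDD_apply, sub_eq_zero]
  exact (inner_hess_eq_inner_divdiv Θ.2 z.2).symm

/-- Conforming test functions do not see the skeleton unknown `û`. -/
lemma TraceGG.pairing_toBroken {𝒯 : Mesh Ω} (q : TraceGG 𝒯) (Θ : HDD Ω) :
    q.pairing (Θ.toBroken 𝒯) = 0 := by
  obtain ⟨_, z, rfl⟩ := q
  change trGG 𝒯 z (Θ.toBroken 𝒯) = 0
  rw [trGG_apply, sub_eq_zero]
  exact (inner_hess_eq_inner_divdiv Θ.2 z.2).symm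

/-! ### The operator `B` -/

lemma norm_toLp_fst {X Y : Type*} [SeminormedAddCommGroup X] [SeminormedAddCommGroup Y]
    (x : X) : ‖WithLp.toLp 2 (x, (0 : Y))‖ = ‖x‖ :=
  WithLp.norm_toLp_fst 2 X Y x

lemma norm_toLp_snd {X Y : Type*} [SeminormedAddCommGroup X] [SeminormedAddCommGroup Y]
    (y : Y) : ‖WithLp.toLp 2 ((0 : X), y)‖ = ‖y‖ :=
  WithLp.norm_toLp_snd 2 X Y y

lemma H2Br.norm_fn_le {𝒯 : Mesh Ω} (z : H2Br 𝒯) : ‖z.fn‖ ≤ ‖z‖ := WithLp.norm_fst_le _ z.1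

lemma H2Br.norm_hess_le {𝒯 : Mesh Ω} (z : H2Br 𝒯) : ‖z.hess‖ ≤ ‖z‖ := WithLp.norm_snd_le _ z.1

lemma HDDBr.norm_fn_le {𝒯 : Mesh Ω} (Θ : HDDBr 𝒯) : ‖Θ.fn‖ ≤ ‖Θ‖ := WithLp.norm_fst_le _ Θ.1

lemma HDDBr.norm_divdiv_le {𝒯 : Mesh Ω} (Θ : HDDBr 𝒯) : ‖Θ.divdiv‖ ≤ ‖Θ‖ :=
  WithLp.norm_snd_le _ Θ.1

lemma abs_bForm_le (E t ν : ℝ) (𝒯 : Mesh Ω) (w : TrialSpace 𝒯) (v : TestSpace 𝒯) :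
    |bForm E t ν 𝒯 w v| ≤ (4 + ‖matCInv (Ω := Ω) E t ν‖) * ‖w‖ * ‖v‖ := by
  set c : ℝ := ‖matCInv (Ω := Ω) E t ν‖ with hc
  have hc0 : 0 ≤ c := norm_nonneg (matCInv (Ω := Ω) E t ν)
  have w1 : ‖w.fst‖ ≤ ‖w‖ := WithLp.norm_fst_le _ w
  have w2 : ‖w.snd‖ ≤ ‖w‖ := WithLp.norm_snd_le _ w
  have w11 := (WithLp.norm_fst_le _ w.fst).trans w1
  have w12 := (WithLp.norm_snd_le _ w.fst).trans w1
  have w21 : ‖w.snd.fst.pairing‖ ≤ ‖w‖ := (WithLp.norm_fst_le _ w.snd).trans w2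
  have w22 : ‖w.snd.snd.pairing‖ ≤ ‖w‖ := (WithLp.norm_snd_le _ w.snd).trans w2
  have v1 : ‖v.fst‖ ≤ ‖v‖ := WithLp.norm_fst_le _ v
  have v2 : ‖v.snd‖ ≤ ‖v‖ := WithLp.norm_snd_le _ v
  have e1 : |⟪w.fst.snd, v.fst.hess + matCInv E t ν v.snd.fn⟫_ℝ| ≤ ‖w‖ * (‖v‖ + c * ‖v‖) := by
    refine (abs_real_inner_le_norm _ _).trans ?_
    refine mul_le_mul w12 ((norm_add_le _ _).trans (add_le_add ?_ ?_)) (norm_nonneg _)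
      (norm_nonneg _)
    · exact (H2Br.norm_hess_le _).trans v1
    · refine ((matCInv (Ω := Ω) E t ν).le_opNorm _).trans ?_
      exact mul_le_mul_of_nonneg_left ((HDDBr.norm_fn_le _).trans v2) hc0
  have e2 : |⟪w.fst.fst, v.snd.divdiv⟫_ℝ| ≤ ‖w‖ * ‖v‖ := by
    refine (abs_real_inner_le_norm _ _).trans ?_
    exact mul_le_mul w11 ((HDDBr.norm_divdiv_le _).trans v2) (norm_nonneg _) (norm_nonneg _)
  have e3 : |w.snd.snd.pairing v.fst| ≤ ‖w‖ * ‖v‖ :=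
    (ContinuousLinearMap.le_opNorm _ _).trans (mul_le_mul w22 v1 (norm_nonneg _) (norm_nonneg _))
  have e4 : |w.snd.fst.pairing v.snd| ≤ ‖w‖ * ‖v‖ :=
    (ContinuousLinearMap.le_opNorm _ _).trans (mul_le_mul w21 v2 (norm_nonneg _) (norm_nonneg _))
  rw [abs_le] at e1 e2 e3 e4 ⊢
  have h : (4 + c) * ‖w‖ * ‖v‖ =
    ‖w‖ * (‖v‖ + c * ‖v‖) + ‖w‖ * ‖v‖ + ‖w‖ * ‖v‖ + ‖w‖ * ‖v‖ := by ring
  rw [h, bForm]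
  constructor <;> linarith

lemma energyNorm_le (E t ν : ℝ) (𝒯 : Mesh Ω) (w : TrialSpace 𝒯) :
    energyNorm E t ν 𝒯 w ≤ (4 + ‖matCInv (Ω := Ω) E t ν‖) * ‖w‖ :=
  (opB E t ν 𝒯 w).opNorm_le_bound (by positivity) fun v => abs_bForm_le E t ν 𝒯 w v

lemma abs_bForm_le_energyNorm (E t ν : ℝ) (𝒯 : Mesh Ω) (w : TrialSpace 𝒯) (v : TestSpace 𝒯) :
    |bForm E t ν 𝒯 w v| ≤ energyNorm E t ν 𝒯 w * ‖v‖ := (opB E t ν 𝒯 w).le_opNorm v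

/-- Testing with `(z, 0)` isolates `q̂`. -/
lemma norm_pairing_snd_le (E t ν : ℝ) (𝒯 : Mesh Ω) (w : TrialSpace 𝒯) :
    ‖w.snd.snd‖ ≤ energyNorm E t ν 𝒯 w + ‖w.fst‖ := by
  have hM : ‖w.fst.snd‖ ≤ ‖w.fst‖ := WithLp.norm_snd_le _ w.fst
  refine ContinuousLinearMap.opNorm_le_bound (TraceDD.pairing w.snd.snd)
    (add_nonneg (norm_nonneg (opB E t ν 𝒯 w)) (norm_nonneg _)) fun z => ?_
  have h1 := abs_bForm_le_energyNorm E t ν 𝒯 w (WithLp.toLp 2 (z, 0))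
  rw [norm_toLp_fst] at h1
  have h2 : bForm E t ν 𝒯 w (WithLp.toLp 2 (z, 0)) =
      ⟪w.fst.snd, z.hess⟫_ℝ + w.snd.snd.pairing z := by
    simp [bForm]
  have h3 : |⟪w.fst.snd, z.hess⟫_ℝ| ≤ ‖w.fst‖ * ‖z‖ := (abs_real_inner_le_norm _ _).trans
    (mul_le_mul hM z.norm_hess_le (norm_nonneg _) (norm_nonneg _))
  rw [h2, abs_le] at h1
  rw [abs_le] at h3
  rw [Real.norm_eq_abs, abs_le, add_mul]
  constructor <;> linarith

/-- Testing with `(0, Θ)` isolates `û`. -/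
lemma norm_pairing_fst_le (E t ν : ℝ) (𝒯 : Mesh Ω) (w : TrialSpace 𝒯) :
    ‖w.snd.fst‖ ≤ energyNorm E t ν 𝒯 w + (1 + ‖matCInv (Ω := Ω) E t ν‖) * ‖w.fst‖ := by
  set c : ℝ := ‖matCInv (Ω := Ω) E t ν‖ with hc
  have hc0 : 0 ≤ c := norm_nonneg (matCInv (Ω := Ω) E t ν)
  have hM : ‖w.fst.snd‖ ≤ ‖w.fst‖ := WithLp.norm_snd_le _ w.fst
  have hu : ‖w.fst.fst‖ ≤ ‖w.fst‖ := WithLp.norm_fst_le _ w.fst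
  refine ContinuousLinearMap.opNorm_le_bound (TraceGG.pairing w.snd.fst)
    (add_nonneg (norm_nonneg (opB E t ν 𝒯 w)) (by positivity)) fun Θ => ?_
  have h1 := abs_bForm_le_energyNorm E t ν 𝒯 w (WithLp.toLp 2 (0, Θ))
  rw [norm_toLp_snd] at h1
  have h2 : bForm E t ν 𝒯 w (WithLp.toLp 2 (0, Θ)) =
      ⟪w.fst.snd, matCInv E t ν Θ.fn⟫_ℝ + ⟪w.fst.fst, Θ.divdiv⟫_ℝ - w.snd.fst.pairing Θ := by
    simp [bForm]
  have h3 : |⟪w.fst.snd, matCInv E t ν Θ.fn⟫_ℝ| ≤ ‖w.fst‖ * (c * ‖Θ‖) := by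
    refine (abs_real_inner_le_norm _ _).trans
      (mul_le_mul hM (((matCInv (Ω := Ω) E t ν).le_opNorm _).trans ?_) (norm_nonneg _)
        (norm_nonneg _))
    exact mul_le_mul_of_nonneg_left Θ.norm_fn_le hc0
  have h4 : |⟪w.fst.fst, Θ.divdiv⟫_ℝ| ≤ ‖w.fst‖ * ‖Θ‖ := (abs_real_inner_le_norm _ _).trans
    (mul_le_mul hu Θ.norm_divdiv_le (norm_nonneg _) (norm_nonneg _))
  rw [h2, abs_le] at h1
  rw [abs_le] at h3 h4
  have h5 : (energyNorm E t ν 𝒯 w + (1 + c) * ‖w.fst‖) * ‖Θ‖ =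
    energyNorm E t ν 𝒯 w * ‖Θ‖ + ‖w.fst‖ * ‖Θ‖ + ‖w.fst‖ * (c * ‖Θ‖) := by ring
  rw [Real.norm_eq_abs, abs_le, h5]
  constructor <;> linarith

/-- `B` is bounded below, uniformly in the mesh. Test functions in `H²₀(Ω) × H(div div, Ω)` do not
see the skeleton unknowns, so the solution of the adjoint problem controls `(u, M)`. -/
lemma exists_norm_le_energyNorm (hd : 0 < d) (hΩ : Bornology.IsBounded Ω) {E t ν : ℝ}
    (hC : ∀ κ : SymTensor d, κ ≠ 0 → 0 < ⟪matC d E t ν κ, κ⟫_ℝ) :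
    ∃ K : ℝ, 0 ≤ K ∧ ∀ (𝒯 : Mesh Ω) (w : TrialSpace 𝒯), ‖w‖ ≤ K * energyNorm E t ν 𝒯 w := by
  obtain ⟨K, hK, hadj⟩ := exists_adjoint_solution hC hd hΩ
  have hc0 : 0 ≤ ‖matCInv (Ω := Ω) E t ν‖ :=
    norm_nonneg (matCInv (Ω := Ω) E t ν)
  refine ⟨K + (1 + (1 + ‖matCInv (Ω := Ω) E t ν‖) * K) + (1 + K), by positivity, fun 𝒯 w => ?_⟩
  have hN : 0 ≤ energyNorm E t ν 𝒯 w := norm_nonneg (opB E t ν 𝒯 w)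
  have hfst : ‖w.fst‖ ≤ K * energyNorm E t ν 𝒯 w := by
    obtain ⟨z, Θ, h1, h2, h3⟩ := hadj w.fst
    let v : TestSpace 𝒯 := WithLp.toLp 2 (z.toBroken 𝒯, Θ.toBroken 𝒯)
    have hb : bForm E t ν 𝒯 w v = ‖w.fst‖ ^ 2 := by
      have hb1 : bForm E t ν 𝒯 w v = ⟪w.fst.snd, z.hess + matCInv E t ν Θ.fn⟫_ℝ +
          ⟪w.fst.fst, Θ.divdiv⟫_ℝ + w.snd.snd.pairing (z.toBroken 𝒯) -
          w.snd.fst.pairing (Θ.toBroken 𝒯) := rfl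
      rw [hb1, TraceDD.pairing_toBroken, TraceGG.pairing_toBroken, h1, h2,
        WithLp.prod_norm_sq_eq_of_L2, real_inner_self_eq_norm_sq, real_inner_self_eq_norm_sq]
      ring
    have hv : ‖v‖ ≤ K * ‖w.fst‖ := (prod_norm_le_add v).trans h3
    have h4 := (le_abs_self _).trans (abs_bForm_le_energyNorm E t ν 𝒯 w v)
    rw [hb] at h4
    have h5 := h4.trans (mul_le_mul_of_nonneg_left hv hN)
    rcases (norm_nonneg w.fst).eq_or_lt' with h0 | h0
    · rw [h0]
      positivity
    · refine le_of_mul_le_mul_right ?_ h0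
      calc ‖w.fst‖ * ‖w.fst‖ = ‖w.fst‖ ^ 2 := (sq _).symm
        _ ≤ _ := h5
        _ = _ := by ring
  have hq := norm_pairing_snd_le E t ν 𝒯 w
  have hu := norm_pairing_fst_le E t ν 𝒯 w
  have hcf := mul_le_mul_of_nonneg_left hfst
    (show 0 ≤ 1 + ‖matCInv (Ω := Ω) E t ν‖ by positivity)
  have h1 := prod_norm_le_add w
  have h2 := prod_norm_le_add w.snd
  linarith

/-- The ultraweak problem is solvable: if `z ∈ H²₀(Ω)` solves the plate problem
`div div 𝒞 ε∇z = f`, then `(z, -𝒞 ε∇z)` together with the traces of both is a solution. -/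
lemma exists_ultraweak_solution (hd : 0 < d) (hΩ : Bornology.IsBounded Ω) {E t ν : ℝ}
    (hC : ∀ κ : SymTensor d, κ ≠ 0 → 0 < ⟪matC d E t ν κ, κ⟫_ℝ) (𝒯 : Mesh Ω) (f : L2 Ω) :
    ∃ u : TrialSpace 𝒯, IsUltraweakSolution E t ν 𝒯 f u := by
  obtain ⟨K, -, hsolve⟩ := exists_plate_solution hC hd hΩ
  obtain ⟨z, hz, -⟩ := hsolve ((innerSL ℝ f).comp H20.fn)
  let m : WithLp 2 (L2s Ω × L2 Ω) := WithLp.toLp 2 (-matCLp Ω E t ν z.hess, -f)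
  have hm : m ∈ weakDivDivOn Ω Ω := by
    refine mem_weakDivDivOn_of_inner fun φ hφ => ?_
    have h1 : ⟪matCLp Ω E t ν z.hess, φ.snd⟫_ℝ = ⟪f, φ.fst⟫_ℝ := hz ⟨φ, hφ⟩
    change ⟪-matCLp Ω E t ν z.hess, φ.snd⟫_ℝ = ⟪-f, φ.fst⟫_ℝ
    rw [inner_neg_left, inner_neg_left, h1]
  let Θ₀ : HDD Ω := ⟨m, hm⟩
  let zhat : TraceGG 𝒯 := ⟨trGG 𝒯 z, z, rfl⟩
  let qhat : TraceDD 𝒯 := ⟨trDD 𝒯 Θ₀, Θ₀, rfl⟩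
  refine ⟨WithLp.toLp 2 (WithLp.toLp 2 (z.fn, -matCLp Ω E t ν z.hess),
    WithLp.toLp 2 (zhat, qhat)), fun v => ?_⟩
  have h1 : bForm E t ν 𝒯 (WithLp.toLp 2 (WithLp.toLp 2 (z.fn, -matCLp Ω E t ν z.hess),
      WithLp.toLp 2 (zhat, qhat))) v =
      ⟪-matCLp Ω E t ν z.hess, v.fst.hess + matCInv E t ν v.snd.fn⟫_ℝ + ⟪z.fn, v.snd.divdiv⟫_ℝ
      + trDD 𝒯 Θ₀ v.fst - trGG 𝒯 z v.snd := rfl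
  have h2 : ⟪matCLp Ω E t ν z.hess, matCInv E t ν v.snd.fn⟫_ℝ = ⟪z.hess, v.snd.fn⟫_ℝ := by
    rw [inner_matCLp_left, matCLp_matCInv hC]
  have h3 : trDD 𝒯 Θ₀ v.fst =
      ⟪-f, v.fst.fn⟫_ℝ - ⟪-matCLp Ω E t ν z.hess, v.fst.hess⟫_ℝ := trDD_apply 𝒯 Θ₀ v.fst
  rw [h1, h3, trGG_apply, inner_add_right, inner_neg_left, inner_neg_left, inner_neg_left, h2,
    load, real_inner_comm z.hess, real_inner_comm z.fn]
  ring

/-! ### Optimal test functions -/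

lemma bForm_add_left (E t ν : ℝ) (𝒯 : Mesh Ω) (u w : TrialSpace 𝒯) (v : TestSpace 𝒯) :
    bForm E t ν 𝒯 (u + w) v = bForm E t ν 𝒯 u v + bForm E t ν 𝒯 w v := by
  simp only [bForm, WithLp.add_fst, WithLp.add_snd, map_add, add_apply,
    inner_add_left]
  ring

lemma bForm_smul_left (E t ν : ℝ) (𝒯 : Mesh Ω) (c : ℝ) (u : TrialSpace 𝒯) (v : TestSpace 𝒯) :
    bForm E t ν 𝒯 (c • u) v = c * bForm E t ν 𝒯 u v := by
  simp only [bForm, WithLp.smul_fst, WithLp.smul_snd, map_smul, smul_apply,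
    real_inner_smul_left, smul_eq_mul]
  ring

/-- The trial-to-test operator as a linear map. -/
def trialToTestLin (E t ν : ℝ) (𝒯 : Mesh Ω) : TrialSpace 𝒯 →ₗ[ℝ] TestSpace 𝒯 where
  toFun := trialToTest E t ν 𝒯
  map_add' u w := by
    refine ext_inner_right ℝ fun v => ?_
    simp only [inner_add_left, inner_trialToTest, bForm_add_left]
  map_smul' c u := by
    refine ext_inner_right ℝ fun v => ?_
    simp only [real_inner_smul_left, inner_trialToTest, bForm_smul_left, RingHom.id_apply]

lemma norm_trialToTestLin (E t ν : ℝ) (𝒯 : Mesh Ω) (u : TrialSpace 𝒯) :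
    ‖trialToTestLin E t ν 𝒯 u‖ = energyNorm E t ν 𝒯 u :=
  (InnerProductSpace.toDual ℝ (TestSpace 𝒯)).symm.norm_map (opB E t ν 𝒯 u)

/-- Least-squares projection of `u` onto a finite-dimensional subspace, in the seminorm
`w ↦ ‖T w‖`, with its Galerkin orthogonality. -/
lemma exists_least_squares {X V : Type*} [AddCommGroup X] [Module ℝ X] [NormedAddCommGroup V]
    [InnerProductSpace ℝ V] (T : X →ₗ[ℝ] V) (u : X) (S : Submodule ℝ X)
    [FiniteDimensional ℝ S] :
    ∃ s ∈ S, (∀ w ∈ S, ⟪T s, T w⟫_ℝ = ⟪T u, T w⟫_ℝ) ∧ ∀ w ∈ S, ‖T (u - s)‖ ≤ ‖T (u - w)‖ := by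
  obtain ⟨s, hs, hse⟩ := (S.map T).starProjection_apply_mem (T u)
  have horth : ∀ w ∈ S, ⟪T (u - s), T w⟫_ℝ = 0 := fun w hw => by
    rw [map_sub, hse]
    exact Submodule.starProjection_inner_eq_zero (T u) (T w) (Submodule.mem_map_of_mem hw)
  refine ⟨s, hs, fun w hw => ?_, fun w hw => ?_⟩
  · have := horth w hw
    rw [map_sub, inner_sub_left] at this
    linarith
  · have h1 : ‖T (u - s)‖ ^ 2 = ⟪T (u - s), T (u - w)⟫_ℝ := by
      rw [← real_inner_self_eq_norm_sq, show u - w = (u - s) + (s - w) by abel, map_add,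
        inner_add_right, horth _ (S.sub_mem hs hw), add_zero]
    have h2 := h1.trans_le (real_inner_le_norm _ _)
    rcases (norm_nonneg (T (u - s))).eq_or_lt' with h0 | h0
    · rw [h0]
      exact norm_nonneg _
    · rw [sq] at h2
      exact le_of_mul_le_mul_left h2 h0

end

end Plate

theorem theorem2 (d : ℕ) (hd : d = 2 ∨ d = 3)
    (Ω : Set (Plate.Euc d)) (hΩ : Plate.IsLipschitzSet Ω) (hΩ_sc : IsSimplyConnected Ω)
    (E t ν : ℝ) (hE : 0 < E) (ht : 0 < t) (hν : -1 < ν) (hν' : ν ≤ 1 / 2)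
    (hC : ∀ κ : Plate.SymTensor d, κ ≠ 0 → 0 < ⟪Plate.matC d E t ν κ, κ⟫_ℝ) :
    ∃ C : ℝ, 0 < C ∧ ∀ 𝒯 : Plate.Mesh Ω,
      (∀ w : Plate.TrialSpace 𝒯,
        ‖w‖ ≤ C * Plate.energyNorm E t ν 𝒯 w ∧ Plate.energyNorm E t ν 𝒯 w ≤ C * ‖w‖) ∧
      ∀ f : Plate.L2 Ω, ∃ u : Plate.TrialSpace 𝒯,
        Plate.IsUltraweakSolution E t ν 𝒯 f u ∧
        (∀ u' : Plate.TrialSpace 𝒯, Plate.IsUltraweakSolution E t ν 𝒯 f u' → u' = u) ∧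
        ∀ Uh : Submodule ℝ (Plate.TrialSpace 𝒯), FiniteDimensional ℝ Uh →
          ∃ uh : Plate.TrialSpace 𝒯,
            Plate.IsDPGSolution E t ν 𝒯 f Uh uh ∧
            (∀ uh' : Plate.TrialSpace 𝒯, Plate.IsDPGSolution E t ν 𝒯 f Uh uh' → uh' = uh) ∧
            ∀ w ∈ Uh, ‖u - uh‖ ≤ C * ‖u - w‖ := by
  have hd0 : 0 < d := by omega
  obtain ⟨K, hK, hlow⟩ := Plate.exists_norm_le_energyNorm hd0 hΩ.isBounded hC
  set k : ℝ := 4 + ‖Plate.matCInv (Ω := Ω) E t ν‖ with hk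
  have hk0 : 0 < k := by positivity
  have hup : ∀ (𝒯 : Plate.Mesh Ω) (w : Plate.TrialSpace 𝒯),
      Plate.energyNorm E t ν 𝒯 w ≤ k * ‖w‖ := fun 𝒯 w => Plate.energyNorm_le E t ν 𝒯 w
  refine ⟨K + k + K * k, by positivity, fun 𝒯 => ⟨fun w => ⟨?_, ?_⟩, fun f => ?_⟩⟩
  · refine (hlow 𝒯 w).trans (mul_le_mul_of_nonneg_right ?_ (norm_nonneg (Plate.opB E t ν 𝒯 w)))
    linarith [mul_nonneg hK hk0.le]
  · refine (hup 𝒯 w).trans (mul_le_mul_of_nonneg_right ?_ (norm_nonneg w))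
    linarith [mul_nonneg hK hk0.le]
  have hT0 : ∀ w : Plate.TrialSpace 𝒯, Plate.trialToTestLin E t ν 𝒯 w = 0 → w = 0 :=
    fun w hw => by
      have h1 := hlow 𝒯 w
      rw [← Plate.norm_trialToTestLin, hw, norm_zero, mul_zero] at h1
      exact norm_le_zero_iff.1 h1
  have hinner : ∀ (w : Plate.TrialSpace 𝒯) (v : Plate.TestSpace 𝒯),
      ⟪Plate.trialToTestLin E t ν 𝒯 w, v⟫_ℝ = Plate.bForm E t ν 𝒯 w v :=
    Plate.inner_trialToTest E t ν 𝒯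
  obtain ⟨u, hu⟩ := Plate.exists_ultraweak_solution hd0 hΩ.isBounded hC 𝒯 f
  refine ⟨u, hu, fun u' hu' => ?_, fun Uh _ => ?_⟩
  · refine sub_eq_zero.1 (hT0 _ (ext_inner_right ℝ fun v => ?_))
    rw [map_sub, inner_sub_left, hinner, hinner, hu v, hu' v, sub_self, inner_zero_left]
  · obtain ⟨uh, huh, horth, hbest⟩ :=
      Plate.exists_least_squares (Plate.trialToTestLin E t ν 𝒯) u Uh
    have hdpg : ∀ w ∈ Uh, Plate.bForm E t ν 𝒯 uh (Plate.trialToTest E t ν 𝒯 w) =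
        Plate.load 𝒯 f (Plate.trialToTest E t ν 𝒯 w) := fun w hw => by
      rw [← hu, ← hinner, ← hinner]
      exact horth w hw
    refine ⟨uh, ⟨huh, hdpg⟩, fun uh' huh' => ?_, fun w hw => ?_⟩
    · refine sub_eq_zero.1 (hT0 _ (inner_self_eq_zero (𝕜 := ℝ).1 ?_))
      have h1 := Uh.sub_mem huh'.1 huh
      have h2 := (huh'.2 _ h1).trans (hdpg _ h1).symm
      rw [← hinner, ← hinner, ← sub_eq_zero, ← inner_sub_left, ← map_sub] at h2
      exact h2
    · have h1 := hlow 𝒯 (u - uh)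
      have h2 := hbest w hw
      rw [Plate.norm_trialToTestLin, Plate.norm_trialToTestLin] at h2
      calc ‖u - uh‖ ≤ K * (k * ‖u - w‖) :=
            h1.trans (mul_le_mul_of_nonneg_left (h2.trans (hup 𝒯 _)) hK)
        _ = K * k * ‖u - w‖ := by ring
        _ ≤ _ := mul_le_mul_of_nonneg_right (by linarith) (norm_nonneg _)
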